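/- Let $(\mathcal X,d)$ be a finite metric space of contexts with $N:=|\mathcal X|\ge 2$, and let $K,M,T\ge 1$ be integers. There are actions $1,\dots,K$ and an abstention action $\square$. Nature fixes in advance contexts $x_t\in\mathcal X$ and reward vectors $r_t\in[-1,1]^K$ for $t=1,\dots,T$, and $r_{t,\square}:=0$; on trial $t$ the learner sees $x_t$, draws an action $a_t\in\{1,\dots,K\}\cup\{\square\}$, and observes only $r_{t,a_t}$. A ball is a set $\{z\in\mathcal X: d(x,z)\le\delta\}$ with $x\in\mathcal X$, $\delta\ge 0$; $\mathcal B$ denotes the set of all balls. The algorithm CBA with parameters $\eta\in(0,1)$ and $w_1\in\mathbb R_{>0}^{E}$, where the experts are the pairs $E=\mathcal B\times\{1,\dots,K\}$ and the expert $i=(B,k)$ has $e^{i}_{t,a}=1$ if $x_t\in B$ and $a=k$, and $e^i_{t,a}=0$ otherwise, works as follows on trial $t$. With $c_{t,i}=\sum_a e^i_{t,a}$, put $\tilde w_{t,i}=w_{t,i}$ if $\sum_i c_{t,i}w_{t,i}\le 1$, and otherwise $\tilde w_{t,i}=w_{t,i}e^{-\lambda c_{t,i}}$, where $\lambda>0$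 is such that $\sum_i c_{t,i}w_{t,i}e^{-\lambda c_{t,i}}=1$. Put $s_t=\sum_i\tilde w_{t,i}e^i_t$, draw $a_t=a$ with probability $s_{t,a}$ for $a\le K$ and $a_t=\square$ with the remaining probability, put $\hat r_{t,a}=1-\mathbf 1[a=a_t](1-r_{t,a_t})/s_{t,a_t}$ for $a\le K$, and set $w_{t+1,i}=\tilde w_{t,i}\exp(\eta\sum_a e^i_{t,a}\hat r_{t,a})$. There are a single program for a real-number random access machine (unit-cost operations, including $\exp$, $\ln$ and square root, on exact reals; addition, subtraction and halving of natural numbers; drawing from a distribution on $K+1$ actions costs $K+1$ steps) and an absolute constant $C$ such that, for all $\mathcal X,d,K,M,T$ as above, given $N,K,M,T$ and the distance matrix, the program after a preparation phase before the first trial has the following properties. 1. It implements CBA with the above experts, for some $\eta\in(0,1)$ and $w_1\in\mathbb R_{>0}^{E}$ that depend only on $(\mathcal X,d),K,M,T$ (and the numbering of the contexts): after every history it computes the same stochastic action $s_t$ as CBA. 2. Every trial takes at most $C\,KN\ln N$ steps. 3. For all contexts $x_1,\dots,x_T$, all reward vectors $r_1,\dots,r_T\in[-1,1]^K$, all pairwise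 disjoint balls $B_1,\dots,B_M$ and all actions $b_1,\dots,b_M\in\{1,\dots,K\}$, $$\sum_{t=1}^T\mathbb E[r_{t,a_t}]\ \ge\ \sum_{t=1}^T\sum_{j=1}^M\mathbf 1[x_t\in B_j]\,r_{t,b_j}-\sqrt{4M\ln\bigl(\max\{N,K/M\}\bigr)(6K+1)T}.$$ In particular, whenever $K\le MN$ the last term is $\sqrt{4M\ln(N)(6K+1)T}$. -/

import Mathlib

noncomputable section

namespace CBA

/-! ## Learners

A learner with internal state `S` plays against contexts in `X` and the actions
`Option (Fin K)`, where `none` is the abstention action. A vector `p : Fin K → ℝ` with nonnegative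
entries of sum at most one stands for the distribution giving `p a` to each action `a` and the
remaining mass to abstention. -/

structure Learner (S X : Type*) (K : ℕ) where
  /-- state before the first trial -/
  start : S
  /-- stochastic action chosen in the current state when the given context is revealed -/
  predict : S → X → Fin K → ℝ
  /-- state after the trial: context, action drawn, reward observed -/
  update : S → X → Option (Fin K) → ℝ → S

/-- Stochastic actions. -/
def IsStochasticAction {K : ℕ} (p : Fin K → ℝ) : Prop :=
  (∀ a, 0 ≤ p a) ∧ ∑ a, p a ≤ 1

/-- Probability of each action under a stochastic action. -/
def prob {K : ℕ} (p : Fin K → ℝ) : Option (Fin K) → ℝ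
  | none => 1 - ∑ a, p a
  | some a => p a

/-- Abstention always has reward zero. -/
def rewardOf {K : ℕ} (r : Fin K → ℝ) : Option (Fin K) → ℝ
  | none => 0
  | some a => r a

namespace Learner

variable {S X : Type*} {K : ℕ}

/-- State reached after a history, a list of triples (context, action, observed reward), the
earliest trial first. -/
def stateAfter (L : Learner S X K) (h : List (X × Option (Fin K) × ℝ)) : S :=
  h.foldl (fun s z => L.update s z.1 z.2.1 z.2.2) L.start

/-- Expected total reward on the trials `t, t + 1, …, t + n - 1`, when trial `t` is entered in
state `s`: on each trial an action is drawn from the stochastic action that the learner chose. -/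
def expectedFrom (L : Learner S X K) (x : ℕ → X) (r : ℕ → Fin K → ℝ) : ℕ → ℕ → S → ℝ
  | 0, _, _ => 0
  | n + 1, t, s =>
      ∑ a : Option (Fin K), prob (L.predict s (x t)) a *
        (rewardOf (r t) a +
          expectedFrom L x r n (t + 1) (L.update s (x t) a (rewardOf (r t) a)))

/-- Expected cumulative reward over the trials `0, …, T - 1`. -/
def expectedReward (L : Learner S X K) (x : ℕ → X) (r : ℕ → Fin K → ℝ) (T : ℕ) : ℝ :=
  L.expectedFrom x r T 0 L.start

end Learner

/-! ## The algorithm CBA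

`ε i a` is the probability that expert `i` gives to action `a` on the current trial, and `w` is
the current weight vector. -/

section Algorithm

variable {E : Type*} [Fintype E] {K : ℕ}

/-- Confidence of an expert: the 1-norm of its stochastic action. -/
def confidence (ε : E → Fin K → ℝ) (i : E) : ℝ := ∑ a, |ε i a|

/-- The multiplier `lam > 0` with `∑ i, c i * w i * exp (-lam * c i) = 1`. It exists and is unique
when `∑ i, c i * w i > 1`, the only case in which it is used. -/
def multiplier (c w : E → ℝ) : ℝ :=
  sInf {lam : ℝ | 0 < lam ∧ ∑ i, c i * w i * Real.exp (-lam * c i) = 1}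

open Classical in
/-- Relative-entropy projection onto the weight vectors that are valid on the current trial. -/
def project (ε : E → Fin K → ℝ) (w : E → ℝ) : E → ℝ :=
  if ∑ i, confidence ε i * w i ≤ 1 then w
  else fun i => w i * Real.exp (-multiplier (confidence ε) w * confidence ε i)

/-- The stochastic action played. -/
def mixture (ε : E → Fin K → ℝ) (w : E → ℝ) (a : Fin K) : ℝ :=
  ∑ i, project ε w i * ε i a

/-- Reward estimator, from the stochastic action `s`, the action drawn and its reward. -/
def estimate (s : Fin K → ℝ) (drawn : Option (Fin K)) (rew : ℝ) (a : Fin K) : ℝ :=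
  1 - (if drawn = some a then (1 - rew) / s a else 0)

/-- The weights for the next trial. -/
def nextWeights (η : ℝ) (ε : E → Fin K → ℝ) (w : E → ℝ) (drawn : Option (Fin K)) (rew : ℝ)
    (i : E) : ℝ :=
  project ε w i * Real.exp (η * ∑ a, ε i a * estimate (mixture ε w) drawn rew a)

/-- CBA with learning rate `η` and initial weights `w₁`, for experts whose stochastic action is a
function of the current context. -/
def algorithm {X : Type*} (η : ℝ) (w₁ : E → ℝ) (ε : X → E → Fin K → ℝ) :
    Learner (E → ℝ) X K where
  start := w₁
  predict w x := mixture (ε x) w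
  update w x a rew := nextWeights η (ε x) w a rew

end Algorithm

/-! ## The basis of metric balls -/

/-- The metric balls of `X`, as a set of subsets of `X`. -/
def Ball (X : Type*) [MetricSpace X] : Type _ :=
  {B : Set X // ∃ (x : X) (δ : ℝ), 0 ≤ δ ∧ B = {z | dist x z ≤ δ}}

instance {X : Type*} [MetricSpace X] [Finite X] : Finite (Ball X) := by
  unfold Ball; infer_instance

instance {X : Type*} [MetricSpace X] [Finite X] : Fintype (Ball X) := Fintype.ofFinite _

open Classical in
/-- The expert of the pair `(B, k)` plays `k` when the context lies in `B` and abstains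
otherwise. -/
def ballExpert {X : Type*} [MetricSpace X] {K : ℕ} (x : X) (i : Ball X × Fin K) (a : Fin K) : ℝ :=
  if x ∈ i.1.1 ∧ a = i.2 then 1 else 0

/-! ## The machine model

A real-number random access machine, programmed in a structured language. The memory has
arrays of natural numbers and arrays of exact real numbers, all with three indices (scalars are
cells with index `0, 0, 0`). Every node of every expression and every command executed, including
every turn of a loop, costs one step. On natural numbers there are only addition, truncated
subtraction and halving, and reals cannot be turned into natural numbers other than through
comparisons. -/

structure Mem where
  nat : ℕ → ℕ → ℕ → ℕ → ℕ
  real : ℕ → ℕ → ℕ → ℕ → ℝ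

def Mem.setNat (m : Mem) (arr i j k v : ℕ) : Mem :=
  { m with nat := fun arr' i' j' k' =>
      if arr' = arr ∧ i' = i ∧ j' = j ∧ k' = k then v else m.nat arr' i' j' k' }

def Mem.setReal (m : Mem) (arr i j k : ℕ) (v : ℝ) : Mem :=
  { m with real := fun arr' i' j' k' =>
      if arr' = arr ∧ i' = i ∧ j' = j ∧ k' = k then v else m.real arr' i' j' k' }

/-- Natural-number expressions. -/
inductive NExp where
  | const (n : ℕ)
  | read (arr : ℕ) (i j k : NExp)
  | plus (a b : NExp)
  | minus (a b : NExp)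
  | half (a : NExp)

namespace NExp

def eval (m : Mem) : NExp → ℕ
  | const n => n
  | read arr i j k => m.nat arr (i.eval m) (j.eval m) (k.eval m)
  | plus a b => a.eval m + b.eval m
  | minus a b => a.eval m - b.eval m
  | half a => a.eval m / 2

def cost : NExp → ℕ
  | const _ => 1
  | read _ i j k => i.cost + j.cost + k.cost + 1
  | plus a b => a.cost + b.cost + 1
  | minus a b => a.cost + b.cost + 1
  | half a => a.cost + 1

end NExp

/-- Real expressions. -/
inductive RExp where
  | ofNat (a : NExp)
  | read (arr : ℕ) (i j k : NExp)
  | plus (a b : RExp)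
  | minus (a b : RExp)
  | times (a b : RExp)
  | divide (a b : RExp)
  | exp (a : RExp)
  | log (a : RExp)
  | sqrt (a : RExp)

namespace RExp

def eval (m : Mem) : RExp → ℝ
  | ofNat a => (a.eval m : ℝ)
  | read arr i j k => m.real arr (i.eval m) (j.eval m) (k.eval m)
  | plus a b => a.eval m + b.eval m
  | minus a b => a.eval m - b.eval m
  | times a b => a.eval m * b.eval m
  | divide a b => a.eval m / b.eval m
  | exp a => Real.exp (a.eval m)
  | log a => Real.log (a.eval m)
  | sqrt a => Real.sqrt (a.eval m)

def cost : RExp → ℕ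
  | ofNat a => a.cost + 1
  | read _ i j k => i.cost + j.cost + k.cost + 1
  | plus a b => a.cost + b.cost + 1
  | minus a b => a.cost + b.cost + 1
  | times a b => a.cost + b.cost + 1
  | divide a b => a.cost + b.cost + 1
  | exp a => a.cost + 1
  | log a => a.cost + 1
  | sqrt a => a.cost + 1

end RExp

/-- Tests. -/
inductive Test where
  | natLe (a b : NExp)
  | realLe (a b : RExp)

namespace Test

def holds (m : Mem) : Test → Prop
  | natLe a b => a.eval m ≤ b.eval m
  | realLe a b => a.eval m ≤ b.eval m

def cost : Test → ℕ
  | natLe a b => a.cost + b.cost + 1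
  | realLe a b => a.cost + b.cost + 1

end Test

/-- Commands. `loop v n c` evaluates `n` once and then runs `c` with the counter, the scalar of
the natural-number array `v`, set to `0, 1, …, n - 1` in turn. -/
inductive Cmd where
  | skip
  | setNat (arr : ℕ) (i j k : NExp) (e : NExp)
  | setReal (arr : ℕ) (i j k : NExp) (e : RExp)
  | seq (c d : Cmd)
  | ite (b : Test) (c d : Cmd)
  | loop (v : ℕ) (n : NExp) (c : Cmd)

namespace Cmd

/-- The memory after `n` turns of a loop with counter `v`, whose body acts as `f`. -/
def iter (f : Mem → Mem) (v : ℕ) (m : Mem) : ℕ → Mem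
  | 0 => m
  | n + 1 => f ((iter f v m n).setNat v 0 0 0 n)

open Classical in
/-- The memory after a command. -/
def exec : Cmd → Mem → Mem
  | skip, m => m
  | setNat arr i j k e, m => m.setNat arr (i.eval m) (j.eval m) (k.eval m) (e.eval m)
  | setReal arr i j k e, m => m.setReal arr (i.eval m) (j.eval m) (k.eval m) (e.eval m)
  | seq c d, m => d.exec (c.exec m)
  | ite b c d, m => if b.holds m then c.exec m else d.exec m
  | loop v n c, m => iter c.exec v m (n.eval m)

open Classical in
/-- The number of steps that a command takes. -/
def time : Cmd → Mem → ℕ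
  | skip, _ => 1
  | setNat _ i j k e, _ => i.cost + j.cost + k.cost + e.cost + 1
  | setReal _ i j k e, _ => i.cost + j.cost + k.cost + e.cost + 1
  | seq c d, m => c.time m + d.time (c.exec m) + 1
  | ite b c d, m => b.cost + (if b.holds m then c.time m else d.time m) + 1
  | loop v n c, m => n.cost + 1 +
      ∑ t ∈ Finset.range (n.eval m), (c.time ((iter c.exec v m t).setNat v 0 0 0 t) + 1)

end Cmd

/-- An online program: one routine that is run once before the first trial, one that computes the
stochastic action once the context is known, and one that processes the observed reward. -/
structure Program where
  prepare : Cmd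
  choose : Cmd
  learn : Cmd

/-- The memory at the very beginning. The natural-number scalars `0, 1, 2, 3` hold the number of
contexts, `K`, `M` and `T`, and the real array `0` holds the distance matrix, the contexts being
numbered by `lab`. All other cells are zero. -/
def inputMem {X : Type*} [Fintype X] [MetricSpace X] (lab : X ≃ Fin (Fintype.card X))
    (K M T : ℕ) : Mem where
  nat arr i j k :=
    if i = 0 ∧ j = 0 ∧ k = 0 then
      (if arr = 0 then Fintype.card X else if arr = 1 then K else if arr = 2 then M
        else if arr = 3 then T else 0)
    else 0
  real arr i j k :=
    if h : arr = 0 ∧ k = 0 ∧ i < Fintype.card X ∧ j < Fintype.card X then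
      dist (lab.symm ⟨i, h.2.2.1⟩) (lab.symm ⟨j, h.2.2.2⟩)
    else 0

namespace Program

variable {X : Type*} [Fintype X] {K : ℕ}

/-- The number of the current context is placed in the natural-number scalar `4`. -/
def withContext (lab : X ≃ Fin (Fintype.card X)) (m : Mem) (x : X) : Mem :=
  m.setNat 4 0 0 0 (lab x)

/-- The action drawn (`K` for abstention) is placed in the natural-number scalar `5`, and the
observed reward in the scalar of the real array `2`. -/
def withFeedback (m : Mem) (a : Option (Fin K)) (rew : ℝ) : Mem :=
  (m.setNat 5 0 0 0 (a.elim K fun b => (b : ℕ))).setReal 2 0 0 0 rew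

/-- The memory after the routine `choose`. -/
def chosen (A : Program) (lab : X ≃ Fin (Fintype.card X)) (m : Mem) (x : X) : Mem :=
  A.choose.exec (withContext lab m x)

/-- The learner that a program implements. The stochastic action is read from the real array `1`,
the probability of action `a` from its cell `a, 0, 0`. -/
def learner [MetricSpace X] (A : Program) (lab : X ≃ Fin (Fintype.card X)) (K M T : ℕ) :
    Learner Mem X K where
  start := A.prepare.exec (inputMem lab K M T)
  predict m x a := (A.chosen lab m x).real 1 a 0 0
  update m x a rew := A.learn.exec (withFeedback (A.chosen lab m x) a rew)

/-- The time of one trial that starts with memory `m`. Drawing an action from a distribution on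
`K + 1` actions is charged `K + 1` steps. -/
def trialTime (A : Program) (lab : X ≃ Fin (Fintype.card X)) (m : Mem) (x : X)
    (a : Option (Fin K)) (rew : ℝ) : ℕ :=
  A.choose.time (withContext lab m x) + (K + 1) +
    A.learn.time (withFeedback (A.chosen lab m x) a rew)

end Program

end CBA

end

/-! The regret bound is a potential argument. The potential is the unnormalised relative entropy
(`divergence`) of the comparator, which puts mass one on each expert `(B j, b j)`, with respect to
the current weights. Ball experts have confidence 0 or 1, so the projection just divides the weights
of the balls around the context by `scale`, the larger of 1 and their total. Disjointness puts each
context in at most one `B j`, so the comparator is valid on every trial and the projection cannot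
raise the potential. The estimator is unbiased and `exp_estimate_le` bounds its second-order effect,
so `expected_divergence_le` lets the potential rise in expectation by at most `η` times the regret
of the trial (learner's reward minus comparator's) plus `2 * K * η ^ 2`. Since the potential is
nonnegative, telescoping (`expectedFrom_ge`) bounds the total regret by initial potential over `η`
plus `2 * K * η * T`, and `rate` balances the two terms.

For speed, every ball is written as `ballThrough z y`: the points no farther from `z` than `y` is.
For each centre `z` and action `k` a binary tree has leaves ordered by distance rank from `z`, and
the balls around `z` that contain `x` form the suffix of leaves starting at the rank of `x`. A trial
therefore needs one suffix sum and one suffix multiplication in each of `K * N` trees of depth about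
`log N`; pending factors on right edges make both logarithmic (`Represents.query_eq`,
`Represents.scale`).

A ball may be described by many pairs `(z, y)`. Its weight is shared equally among them, and the
initial weight is proportional to their number (`multiplicity`). Thus every pair starts with the
same share, the program never has to detect equal balls, and the initial weights sum to `M` while
each is at least `M / (K * N ^ 2)`. This bounds the initial potential by `3 * M * log (max N (K /
M))`.

The program is verified by loop invariants: `Ready` describes the memory by leaf weights, `Linked`
relates leaf weights to CBA's weights, and every routine preserves both. Equality of predictions
then transfers the reward bound from CBA to the program. -/

noncomputable section

namespace CBA

/-! ### CBA specialised to ball experts: closed forms and positivity. -/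

section Experts

variable {X : Type*} [MetricSpace X] {K : ℕ}

open Classical in
theorem confidence_ballExpert (x : X) (i : Ball X × Fin K) :
    confidence (ballExpert x) i = if x ∈ i.1.1 then 1 else 0 := by
  unfold confidence ballExpert
  by_cases h : x ∈ i.1.1 <;> simp [h, apply_ite abs]

open Classical in
theorem sum_ballExpert_mul (x : X) (i : Ball X × Fin K) (g : Fin K → ℝ) :
    ∑ a, ballExpert x i a * g a = if x ∈ i.1.1 then g i.2 else 0 := by
  unfold ballExpert
  by_cases h : x ∈ i.1.1 <;> simp [h]

/-- The ball around `z` whose boundary contains `y`. -/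
def ballThrough (z y : X) : Ball X := ⟨{v | dist z v ≤ dist z y}, z, dist z y, dist_nonneg, rfl⟩

theorem mem_ballThrough {x z y : X} : x ∈ (ballThrough z y).1 ↔ dist z x ≤ dist z y := Iff.rfl

theorem Ball.nonempty (B : Ball X) : B.1.Nonempty := by
  obtain ⟨B, z, δ, hδ, rfl⟩ := B
  exact ⟨z, by simpa using hδ⟩

/-- This is the validity of the comparator on every trial: its total confidence never exceeds one.
-/
theorem card_containing_le_one {M : ℕ} {B : Fin M → Ball X}
    (hB : ∀ i j, i ≠ j → Disjoint (B i).1 (B j).1) (x : X) [∀ j, Decidable (x ∈ (B j).1)] :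
    (∑ j, if x ∈ (B j).1 then (1 : ℝ) else 0) ≤ 1 := by
  rw [Finset.sum_boole]
  have : (Finset.univ.filter fun j => x ∈ (B j).1).card ≤ 1 := by
    refine Finset.card_le_one.2 fun i hi j hj => ?_
    by_contra hne
    exact Set.disjoint_left.1 (hB i j hne) (Finset.mem_filter.1 hi).2 (Finset.mem_filter.1 hj).2
  exact_mod_cast this

variable [Finite X]

open Classical in
/-- Total weight of the experts that play `k` when the context is `x`. -/
def activeWeight (x : X) (w : Ball X × Fin K → ℝ) (k : Fin K) : ℝ :=
  ∑ B : Ball X, if x ∈ B.1 then w (B, k) else 0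

/-- The factor by which the projection divides the weights of the confident experts. -/
def scale (x : X) (w : Ball X × Fin K → ℝ) : ℝ := max 1 (∑ k, activeWeight x w k)

theorem one_le_scale (x : X) (w : Ball X × Fin K → ℝ) : 1 ≤ scale x w := le_max_left _ _

theorem scale_pos (x : X) (w : Ball X × Fin K → ℝ) : 0 < scale x w :=
  zero_lt_one.trans_le (one_le_scale x w)

theorem sum_confidence_mul (x : X) (w : Ball X × Fin K → ℝ) :
    ∑ i, confidence (ballExpert x) i * w i = ∑ k, activeWeight x w k := by
  classical
  simp_rw [confidence_ballExpert, activeWeight]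
  rw [Fintype.sum_prod_type_right]
  simp

/-- With 0/1 confidences the defining equation reads `A * exp (-lam) = 1`, where `A` is the total
active weight, so the set under the infimum is the singleton of `log A`. -/
theorem multiplier_ballExpert (x : X) (w : Ball X × Fin K → ℝ)
    (h : 1 < ∑ k, activeWeight x w k) :
    multiplier (confidence (ballExpert x)) w = Real.log (∑ k, activeWeight x w k) := by
  classical
  have key : ∀ lam : ℝ, ∑ i, confidence (ballExpert x) i * w i *
      Real.exp (-lam * confidence (ballExpert x) i) =
        (∑ k, activeWeight x w k) * Real.exp (-lam) := by
    intro lam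
    rw [← sum_confidence_mul, Finset.sum_mul]
    refine Finset.sum_congr rfl fun i _ => ?_
    rw [confidence_ballExpert]
    split_ifs <;> simp
  have : {lam : ℝ | 0 < lam ∧ ∑ i, confidence (ballExpert x) i * w i *
      Real.exp (-lam * confidence (ballExpert x) i) = 1} =
        {Real.log (∑ k, activeWeight x w k)} := by
    ext lam
    simp only [key, Set.mem_ofPred_eq, Set.mem_singleton_iff]
    have hpos : 0 < ∑ k, activeWeight x w k := by linarith
    constructor
    · rintro ⟨-, h1⟩
      rw [Real.exp_neg, ← div_eq_mul_inv, div_eq_one_iff_eq (Real.exp_pos _).ne'] at h1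
      rw [h1, Real.log_exp]
    · rintro rfl
      refine ⟨Real.log_pos h, ?_⟩
      rw [Real.exp_neg, Real.exp_log hpos, mul_inv_cancel₀ hpos.ne']
  unfold multiplier
  rw [this, csInf_singleton]

open Classical in
theorem project_ballExpert (x : X) (w : Ball X × Fin K → ℝ) (i : Ball X × Fin K) :
    project (ballExpert x) w i = if x ∈ i.1.1 then w i / scale x w else w i := by
  unfold project
  rw [sum_confidence_mul]
  split_ifs with h h1 h1
  · simp [scale, max_eq_left h]
  · rfl
  · push Not at h
    have hpos : 0 < ∑ k, activeWeight x w k := by linarith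
    simp only [confidence_ballExpert, h1, if_true, mul_one]
    rw [multiplier_ballExpert x w h, scale, max_eq_right h.le, Real.exp_neg, Real.exp_log hpos,
      div_eq_mul_inv]
  · simp [confidence_ballExpert, h1]

theorem mixture_ballExpert (x : X) (w : Ball X × Fin K → ℝ) (k : Fin K) :
    mixture (ballExpert x) w k = activeWeight x w k / scale x w := by
  classical
  unfold mixture activeWeight
  rw [Fintype.sum_prod_type, Finset.sum_div]
  refine Finset.sum_congr rfl fun B _ => ?_
  simp_rw [project_ballExpert, ballExpert]
  by_cases h : x ∈ B.1 <;> simp [h]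

open Classical in
theorem nextWeights_ballExpert (η : ℝ) (x : X) (w : Ball X × Fin K → ℝ) (o : Option (Fin K))
    (rew : ℝ) (i : Ball X × Fin K) :
    nextWeights η (ballExpert x) w o rew i =
      if x ∈ i.1.1 then w i / scale x w *
        Real.exp (η * estimate (mixture (ballExpert x) w) o rew i.2) else w i := by
  unfold nextWeights
  rw [sum_ballExpert_mul, project_ballExpert]
  split_ifs <;> simp

theorem nextWeights_pos {η : ℝ} {x : X} {w : Ball X × Fin K → ℝ} (hw : ∀ i, 0 < w i)
    (o : Option (Fin K)) (rew : ℝ) (i : Ball X × Fin K) :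
    0 < nextWeights η (ballExpert x) w o rew i := by
  classical
  rw [nextWeights_ballExpert]
  have := scale_pos x w
  have := hw i
  split_ifs <;> positivity

/-- By finiteness the radius can be shrunk to the distance of the farthest point in the ball. Hence
balls are indexed, with repetitions, by pairs of points. -/
theorem Ball.exists_eq_ballThrough (B : Ball X) : ∃ z y, B = ballThrough z y := by
  obtain ⟨B, z, δ, hδ, rfl⟩ := B
  obtain ⟨y, hy, hmax⟩ := Set.exists_max_image {v | dist z v ≤ δ} (dist z) (Set.toFinite _)
    ⟨z, by simpa using hδ⟩
  refine ⟨z, y, Subtype.ext ?_⟩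
  ext v
  exact ⟨fun hv => hmax v hv, fun hv => show dist z v ≤ δ from le_trans hv hy⟩

/-- The ball of radius zero at `x` always contributes. Consequently every action has positive
probability and the estimator never divides by zero. -/
theorem activeWeight_pos {x : X} {w : Ball X × Fin K → ℝ} (hw : ∀ i, 0 < w i) (k : Fin K) :
    0 < activeWeight x w k := by
  classical
  refine Finset.sum_pos' (fun B _ => ?_) ⟨ballThrough x x, Finset.mem_univ _, ?_⟩
  · have := hw (B, k)
    split_ifs <;> positivity
  · rw [if_pos (by simp [mem_ballThrough])]
    exact hw _

theorem mixture_pos {x : X} {w : Ball X × Fin K → ℝ} (hw : ∀ i, 0 < w i) (k : Fin K) :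
    0 < mixture (ballExpert x) w k := by
  rw [mixture_ballExpert]
  exact div_pos (activeWeight_pos hw k) (scale_pos x w)

theorem sum_mixture_le_one {x : X} {w : Ball X × Fin K → ℝ} :
    ∑ k, mixture (ballExpert x) w k ≤ 1 := by
  simp_rw [mixture_ballExpert]
  rw [← Finset.sum_div, div_le_one (scale_pos x w)]
  exact le_max_right _ _

theorem mixture_isStochasticAction {x : X} {w : Ball X × Fin K → ℝ} (hw : ∀ i, 0 < w i) :
    IsStochasticAction (mixture (ballExpert x) w) :=
  ⟨fun k => (mixture_pos hw k).le, sum_mixture_le_one⟩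

end Experts

/-! ## Reward analysis -/

/-- Invert the quadratic lower bound for `exp (-y)`, using `(1 - y + y²/2) (1 + y + y²/2) = 1 + y⁴/4
≥ 1`. -/
theorem exp_le_quadratic_of_nonpos {y : ℝ} (hy : y ≤ 0) : Real.exp y ≤ 1 + y + y ^ 2 / 2 := by
  have h := Real.quadratic_le_exp_of_nonneg (neg_nonneg.2 hy)
  have h1 : 0 < 1 - y + y ^ 2 / 2 := by nlinarith [sq_nonneg y]
  have h2 : Real.exp y ≤ (1 - y + y ^ 2 / 2)⁻¹ := by
    rw [← neg_neg y, Real.exp_neg]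
    apply inv_anti₀
    · simpa using h1
    · nlinarith
  refine h2.trans ?_
  rw [inv_le_iff_one_le_mul₀ h1]
  nlinarith [sq_nonneg (y ^ 2)]

theorem exp_le_quadratic_of_le_one {y : ℝ} (h0 : 0 ≤ y) (h1 : y ≤ 1) :
    Real.exp y ≤ 1 + y + y ^ 2 := by
  have := Real.abs_exp_sub_one_sub_id_le (x := y) (by rwa [abs_of_nonneg h0])
  linarith [(abs_le.1 this).2]

/-- The expected exponential gain that one action contributes under importance weighting. -/
theorem exp_estimate_le {s r η : ℝ} (hs : 0 < s) (hs1 : s ≤ 1) (hr : r ∈ Set.Icc (-1 : ℝ) 1)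
    (hη : 0 ≤ η) (hη1 : η ≤ 1) :
    s * ((1 - s) * (Real.exp η - 1) + s * (Real.exp (η * (1 - (1 - r) / s)) - 1)) ≤
      η * (s * r) + 2 * η ^ 2 := by
  obtain ⟨hr0, hr1⟩ := hr
  have h1 := exp_le_quadratic_of_le_one hη hη1
  -- The estimate for the drawn action is `1 - v`. Only its upper side is bounded, so the sign
  -- decides which quadratic bound for `exp` applies.
  obtain ⟨v, hv⟩ : ∃ v, (1 - r) / s = v := ⟨_, rfl⟩
  have hrv : r = 1 - s * v := by rw [← hv]; field_simp; ring
  have hv0 : 0 ≤ v := hv ▸ div_nonneg (by linarith) hs.le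
  rw [hv]
  rcases le_total v 1 with h | h
  · have h2 := exp_le_quadratic_of_le_one (y := η * (1 - v)) (mul_nonneg hη (by linarith))
      (by nlinarith)
    have e1 : (1 - s) * (Real.exp η - 1) ≤ (1 - s) * (η + η ^ 2) :=
      mul_le_mul_of_nonneg_left (by linarith) (by linarith)
    have e2 : s * (Real.exp (η * (1 - v)) - 1) ≤ s * (η * (1 - v) + (η * (1 - v)) ^ 2) :=
      mul_le_mul_of_nonneg_left (by linarith) hs.le
    have e3 : (η * (1 - v)) ^ 2 ≤ η ^ 2 := by
      rw [mul_pow]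
      exact mul_le_of_le_one_right (sq_nonneg _) (by nlinarith)
    have e4 : s * (η * (1 - v) + (η * (1 - v)) ^ 2) ≤ s * (η * (1 - v) + η ^ 2) :=
      mul_le_mul_of_nonneg_left (by linarith) hs.le
    have e5 : s * ((1 - s) * (Real.exp η - 1) + s * (Real.exp (η * (1 - v)) - 1)) ≤
        s * ((1 - s) * (η + η ^ 2) + s * (η * (1 - v) + η ^ 2)) :=
      mul_le_mul_of_nonneg_left (by linarith) hs.le
    rw [hrv]
    nlinarith [mul_nonneg (sub_nonneg.2 hs1) (sq_nonneg η)]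
  · have h2 := exp_le_quadratic_of_nonpos (y := η * (1 - v))
      (mul_nonpos_of_nonneg_of_nonpos hη (by linarith))
    have e1 : (1 - s) * (Real.exp η - 1) ≤ (1 - s) * (η + η ^ 2) :=
      mul_le_mul_of_nonneg_left (by linarith) (by linarith)
    have e2 : s * (Real.exp (η * (1 - v)) - 1) ≤ s * (η * (1 - v) + (η * (1 - v)) ^ 2 / 2) :=
      mul_le_mul_of_nonneg_left (by linarith) hs.le
    have e5 : s * ((1 - s) * (Real.exp η - 1) + s * (Real.exp (η * (1 - v)) - 1)) ≤
        s * ((1 - s) * (η + η ^ 2) + s * (η * (1 - v) + (η * (1 - v)) ^ 2 / 2)) :=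
      mul_le_mul_of_nonneg_left (by linarith) hs.le
    -- The extra factor `s` in front tames the variance: `s ^ 2 * (v - 1) ^ 2 ≤ (2 - s) ^ 2`, and
    -- then `s * (1 - s) + (2 - s) ^ 2 / 2 ≤ 2` yields the constant 2.
    have hsv : s * v ≤ 2 := by linarith
    have e6 : (s * v - s) ^ 2 ≤ (2 - s) ^ 2 := by
      have : 0 ≤ s * v - s := by nlinarith
      nlinarith
    rw [hrv]
    have e7 : s * (1 - s) + (s * v - s) ^ 2 / 2 ≤ 2 := by nlinarith
    nlinarith [mul_le_mul_of_nonneg_left e7 (sq_nonneg η)]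

theorem sum_prob {K : ℕ} (p : Fin K → ℝ) : ∑ o, prob p o = 1 := by
  rw [Fintype.sum_option]; simp [prob]

theorem prob_nonneg {K : ℕ} {p : Fin K → ℝ} (hp : IsStochasticAction p) (o : Option (Fin K)) :
    0 ≤ prob p o := by
  cases o with
  | none => simpa [prob] using hp.2
  | some a => exact hp.1 a

theorem sum_prob_mul_ite {K : ℕ} (p : Fin K → ℝ) (a : Fin K) (u v : ℝ) :
    ∑ o, prob p o * (if o = some a then u else v) = p a * u + (1 - p a) * v := by
  have : ∀ o, prob p o * (if o = some a then u else v) =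
      prob p o * v + if o = some a then prob p o * (u - v) else 0 := by
    intro o; split_ifs <;> ring
  simp_rw [this, Finset.sum_add_distrib, ← Finset.sum_mul, sum_prob]
  simp [prob]; ring

theorem rewardOf_sum {K : ℕ} (p r : Fin K → ℝ) :
    ∑ o, prob p o * rewardOf r o = ∑ a, p a * r a := by
  rw [Fintype.sum_option]; simp [prob, rewardOf]

section Regret

variable {X : Type*} [MetricSpace X] [Finite X] {K M : ℕ}

/-- Relative entropy of the experts `(B j, b j)` with respect to the weights `w`. -/
def divergence (B : Fin M → Ball X) (b : Fin M → Fin K) (w : Ball X × Fin K → ℝ) : ℝ :=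
  ∑ j, (-Real.log (w (B j, b j)) - 1) + ∑ i, w i

/-- Each comparator expert contributes `w - 1 - log w ≥ 0`. The experts `(B j, b j)` are distinct
because disjoint nonempty balls are, so their weights can be split off from the total. -/
theorem divergence_nonneg {B : Fin M → Ball X} {b : Fin M → Fin K}
    (hB : ∀ i j, i ≠ j → Disjoint (B i).1 (B j).1) {w : Ball X × Fin K → ℝ} (hw : ∀ i, 0 < w i) :
    0 ≤ divergence B b w := by
  classical
  have hinj : Function.Injective fun j => (B j, b j) := by
    intro i j hij
    by_contra hne
    have h1 := hB i j hne
    have h2 : B i = B j := congrArg Prod.fst hij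
    rw [h2, disjoint_self] at h1
    exact (B j).nonempty.ne_empty h1
  have h1 : ∑ j, w (B j, b j) ≤ ∑ i, w i := by
    rw [← Finset.sum_image (f := w) (g := fun j => (B j, b j)) (fun i _ j _ h => hinj h)]
    exact Finset.sum_le_sum_of_subset_of_nonneg (Finset.subset_univ _) fun i _ _ => (hw i).le
  have h2 : 0 ≤ ∑ j, (-Real.log (w (B j, b j)) - 1) + ∑ j, w (B j, b j) := by
    rw [← Finset.sum_add_distrib]
    exact Finset.sum_nonneg fun j _ => by linarith [Real.log_le_sub_one_of_pos (hw (B j, b j))]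
  unfold divergence
  linarith

-- The pathwise inequality splits the change of potential into a projection part, which is at most
-- zero, and the exact effect of the exponential update.
open Classical in
theorem divergence_nextWeights_le {B : Fin M → Ball X} (b : Fin M → Fin K)
    (hB : ∀ i j, i ≠ j → Disjoint (B i).1 (B j).1) {w : Ball X × Fin K → ℝ} (hw : ∀ i, 0 < w i)
    (η : ℝ) (x : X) (o : Option (Fin K)) (rew : ℝ) :
    divergence B b (nextWeights η (ballExpert x) w o rew) ≤ divergence B b w -
      η * (∑ j, if x ∈ (B j).1 then estimate (mixture (ballExpert x) w) o rew (b j) else 0) +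
      ∑ a, mixture (ballExpert x) w a *
        (Real.exp (η * estimate (mixture (ballExpert x) w) o rew a) - 1) := by
  set e := estimate (mixture (ballExpert x) w) o rew
  set Z := scale x w with hZ
  have hZ0 : 0 < Z := scale_pos x w
  have hlog : ∑ j, (-Real.log (nextWeights η (ballExpert x) w o rew (B j, b j)) - 1) =
      ∑ j, (-Real.log (w (B j, b j)) - 1) +
      (∑ j, if x ∈ (B j).1 then (1 : ℝ) else 0) * Real.log Z -
        η * ∑ j, if x ∈ (B j).1 then e (b j) else 0 := by
    rw [Finset.sum_mul, Finset.mul_sum, ← Finset.sum_add_distrib, ← Finset.sum_sub_distrib]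
    refine Finset.sum_congr rfl fun j _ => ?_
    rw [nextWeights_ballExpert]
    have := hw (B j, b j)
    split_ifs with h
    · rw [Real.log_mul (by positivity) (Real.exp_pos _).ne', Real.log_exp,
        Real.log_div this.ne' hZ0.ne']
      ring
    · ring
  have hsum : ∑ i, nextWeights η (ballExpert x) w o rew i = ∑ i, w i -
      ∑ k, activeWeight x w k + ∑ a, mixture (ballExpert x) w a * Real.exp (η * e a) := by
    rw [Fintype.sum_prod_type_right, Fintype.sum_prod_type_right, ← Finset.sum_sub_distrib,
      ← Finset.sum_add_distrib]
    refine Finset.sum_congr rfl fun k _ => ?_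
    rw [mixture_ballExpert]
    unfold activeWeight
    rw [← Finset.sum_sub_distrib, Finset.sum_div, Finset.sum_mul, ← Finset.sum_add_distrib]
    refine Finset.sum_congr rfl fun C _ => ?_
    rw [nextWeights_ballExpert]
    dsimp only
    split_ifs <;> ring
  have hmix : ∑ a, mixture (ballExpert x) w a = (∑ k, activeWeight x w k) / Z := by
    simp_rw [mixture_ballExpert]
    rw [Finset.sum_div]
  -- Effect of the projection when the comparator has full confidence: zero if nothing is rescaled,
  -- and `log Z - Z + 1` otherwise.
  have hZle : Real.log Z - ∑ k, activeWeight x w k + (∑ k, activeWeight x w k) / Z ≤ 0 := by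
    rcases le_total (∑ k, activeWeight x w k) 1 with h | h
    · have : Z = 1 := max_eq_left h
      simp [this]
    · have h1 : Z = ∑ k, activeWeight x w k := max_eq_right h
      rw [← h1, div_self hZ0.ne']
      linarith [Real.log_le_sub_one_of_pos hZ0]
  -- The comparator pays `log Z` once per ball containing `x`; since `log Z ≥ 0` and there is at
  -- most one such ball, `hZle` covers this cost.
  have hone := mul_le_mul_of_nonneg_right (card_containing_le_one hB x)
    (Real.log_nonneg (one_le_scale x w))
  unfold divergence
  rw [hlog, hsum]
  simp_rw [mul_sub, mul_one, Finset.sum_sub_distrib]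
  rw [hmix]
  linarith

open Classical in
theorem expected_divergence_le {B : Fin M → Ball X} (b : Fin M → Fin K)
    (hB : ∀ i j, i ≠ j → Disjoint (B i).1 (B j).1) {w : Ball X × Fin K → ℝ} (hw : ∀ i, 0 < w i)
    {η : ℝ} (hη : 0 ≤ η) (hη1 : η ≤ 1) (x : X) {r : Fin K → ℝ}
    (hr : ∀ a, r a ∈ Set.Icc (-1 : ℝ) 1) :
    ∑ o, prob (mixture (ballExpert x) w) o *
        divergence B b (nextWeights η (ballExpert x) w o (rewardOf r o)) ≤
      divergence B b w - η * (∑ j, if x ∈ (B j).1 then r (b j) else 0) +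
        η * (∑ a, mixture (ballExpert x) w a * r a) + 2 * K * η ^ 2 := by
  set s := mixture (ballExpert x) w with hs
  have hs0 : ∀ a, 0 < s a := mixture_pos hw
  have hs1 : ∀ a, s a ≤ 1 := fun a =>
    (Finset.single_le_sum (fun k _ => (hs0 k).le) (Finset.mem_univ a)).trans sum_mixture_le_one
  have hest : ∀ o a, estimate s o (rewardOf r o) a =
      if o = some a then 1 - (1 - r a) / s a else 1 := by
    intro o a
    unfold estimate
    split_ifs with h
    · subst h; rfl
    · simp
  have h1 : ∀ o, prob s o * divergence B b (nextWeights η (ballExpert x) w o (rewardOf r o)) ≤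
      prob s o * divergence B b w -
      η * (∑ j, if x ∈ (B j).1 then
        prob s o * (if o = some (b j) then 1 - (1 - r (b j)) / s (b j) else 1) else 0) +
      ∑ a, s a * (prob s o * (if o = some a then Real.exp (η * (1 - (1 - r a) / s a)) - 1
        else Real.exp η - 1)) := by
    intro o
    refine (mul_le_mul_of_nonneg_left (divergence_nextWeights_le b hB hw η x o _)
      (prob_nonneg (mixture_isStochasticAction hw) o)).trans_eq ?_
    rw [← hs]
    simp_rw [hest]
    rw [mul_add, mul_sub, mul_left_comm, Finset.mul_sum _ _ (prob s o), Finset.mul_sum _ _ (prob s o)]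
    congr 1
    · congr 2
      refine Finset.sum_congr rfl fun j _ => ?_
      rw [mul_ite, mul_zero]
    · refine Finset.sum_congr rfl fun a _ => ?_
      split_ifs
      · ring
      · rw [mul_one]; ring
  refine (Finset.sum_le_sum fun o _ => h1 o).trans ?_
  rw [Finset.sum_add_distrib, Finset.sum_sub_distrib, ← Finset.sum_mul, sum_prob, one_mul,
    ← Finset.mul_sum, Finset.sum_comm, Finset.sum_comm (s := Finset.univ (α := Option (Fin K)))]
  -- Unbiasedness: `s * (1 - (1 - r) / s) + (1 - s) * 1 = r`.
  have h2 : (∑ j, ∑ o, if x ∈ (B j).1 then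
      prob s o * (if o = some (b j) then 1 - (1 - r (b j)) / s (b j) else 1) else 0) =
      ∑ j, if x ∈ (B j).1 then r (b j) else 0 := by
    refine Finset.sum_congr rfl fun j _ => ?_
    split_ifs
    · rw [sum_prob_mul_ite]
      have := (hs0 (b j)).ne'
      field_simp
      ring
    · simp
  have h3 : (∑ a, ∑ o, s a * (prob s o * (if o = some a then
      Real.exp (η * (1 - (1 - r a) / s a)) - 1 else Real.exp η - 1))) ≤
      ∑ a, (η * (s a * r a) + 2 * η ^ 2) := by
    refine Finset.sum_le_sum fun a _ => ?_
    rw [← Finset.mul_sum, sum_prob_mul_ite, add_comm]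
    exact exp_estimate_le (hs0 a) (hs1 a) (hr a) hη hη1
  rw [Finset.sum_add_distrib, ← Finset.mul_sum] at h3
  simp only [Finset.sum_const, Finset.card_univ, Fintype.card_fin, nsmul_eq_mul] at h3
  rw [h2]
  linarith

-- Induction on the number of remaining trials. The current divergence divided by `η` is the loss
-- still to be charged against the comparator; at the end its nonnegativity allows it to be dropped.
open Classical in
theorem expectedFrom_ge {B : Fin M → Ball X} (b : Fin M → Fin K)
    (hB : ∀ i j, i ≠ j → Disjoint (B i).1 (B j).1) (w₁ : Ball X × Fin K → ℝ)
    {η : ℝ} (hη : 0 < η) (hη1 : η ≤ 1) (x : ℕ → X) (r : ℕ → Fin K → ℝ) (n : ℕ) :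
    ∀ (t : ℕ) (w : Ball X × Fin K → ℝ), (∀ i, 0 < w i) →
      (∀ t' < t + n, ∀ a, r t' a ∈ Set.Icc (-1 : ℝ) 1) →
      (∑ t' ∈ Finset.range n, ∑ j, if x (t + t') ∈ (B j).1 then r (t + t') (b j) else 0) -
        divergence B b w / η - n * (2 * K * η) ≤
      (algorithm η w₁ ballExpert).expectedFrom x r n t w := by
  induction n with
  | zero =>
    intro t w hw _
    have := div_nonneg (divergence_nonneg (b := b) hB hw) hη.le
    simp [Learner.expectedFrom, this]
  | succ n ih =>
    intro t w hw hr
    simp only [Learner.expectedFrom, algorithm]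
    set s := mixture (ballExpert (x t)) w with hs
    set W := fun o => nextWeights η (ballExpert (x t)) w o (rewardOf (r t) o) with hW
    set S := ∑ t' ∈ Finset.range n,
      ∑ j, if x (t + 1 + t') ∈ (B j).1 then r (t + 1 + t') (b j) else 0 with hS
    have h1 : ∑ o, prob s o * (rewardOf (r t) o + (S - divergence B b (W o) / η - n * (2 * K * η))) ≤
        ∑ o, prob s o * (rewardOf (r t) o +
          (algorithm η w₁ ballExpert).expectedFrom x r n (t + 1) (W o)) := by
      refine Finset.sum_le_sum fun o _ => mul_le_mul_of_nonneg_left ?_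
        (prob_nonneg (mixture_isStochasticAction hw) o)
      have := ih (t + 1) (W o) (nextWeights_pos hw _ _) (fun t' ht' => hr t' (by omega))
      linarith
    refine le_trans ?_ h1
    have h2 : ∑ o, prob s o *
        (rewardOf (r t) o + (S - divergence B b (W o) / η - n * (2 * K * η))) =
        ∑ a, s a * r t a + (S - n * (2 * K * η)) - (∑ o, prob s o * divergence B b (W o)) / η := by
      rw [← rewardOf_sum, Finset.sum_div, ← one_mul (S - n * (2 * K * η)), ← sum_prob s,
        Finset.sum_mul, ← Finset.sum_add_distrib, ← Finset.sum_sub_distrib]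
      exact Finset.sum_congr rfl fun o _ => by ring
    have h3 := expected_divergence_le b hB hw hη.le hη1 (x t) (hr t (by omega))
    rw [h2, Finset.sum_range_succ']
    have h4 : (∑ o, prob s o * divergence B b (W o)) / η ≤ divergence B b w / η -
        (∑ j, if x t ∈ (B j).1 then r t (b j) else 0) + ∑ a, s a * r t a + 2 * K * η := by
      rw [div_le_iff₀ hη]
      refine h3.trans_eq ?_
      field_simp
      rw [← hs]
    have h5 : (∑ t' ∈ Finset.range n, ∑ j, if x (t + (t' + 1)) ∈ (B j).1 then
        r (t + (t' + 1)) (b j) else 0) = S := by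
      refine Finset.sum_congr rfl fun t' _ => ?_
      rw [show t + (t' + 1) = t + 1 + t' by ring]
    rw [h5]
    push_cast
    simp only [add_zero]
    linarith

-- Crude bound for the regime of small `T`, in which the claimed error term already exceeds `2 * T`.
open Classical in
theorem expectedFrom_ge_neg (w₁ : Ball X × Fin K → ℝ) {η : ℝ} (x : ℕ → X) (r : ℕ → Fin K → ℝ)
    (n : ℕ) :
    ∀ (t : ℕ) (w : Ball X × Fin K → ℝ), (∀ i, 0 < w i) →
      (∀ t' < t + n, ∀ a, r t' a ∈ Set.Icc (-1 : ℝ) 1) →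
      -(n : ℝ) ≤ (algorithm η w₁ ballExpert).expectedFrom x r n t w := by
  induction n with
  | zero => intro t w _ _; simp [Learner.expectedFrom]
  | succ n ih =>
    intro t w hw hr
    simp only [Learner.expectedFrom, algorithm]
    have h1 : ∑ o, prob (mixture (ballExpert (x t)) w) o * (-((n + 1 : ℕ) : ℝ)) =
        -((n + 1 : ℕ) : ℝ) := by
      rw [← Finset.sum_mul, sum_prob, one_mul]
    rw [← h1]
    refine Finset.sum_le_sum fun o _ => mul_le_mul_of_nonneg_left ?_
      (prob_nonneg (mixture_isStochasticAction hw) o)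
    have h2 := ih (t + 1) _ (nextWeights_pos (η := η) (x := x t) hw o (rewardOf (r t) o))
      (fun t' ht' => hr t' (by omega))
    have h3 : -1 ≤ rewardOf (r t) o := by
      cases o with
      | none => simp [rewardOf]
      | some a => exact (hr t (by omega) a).1
    simp only [algorithm] at h2
    push_cast
    linarith

end Regret

/-- Learners with the same behaviour collect the same expected reward. -/
theorem Learner.expectedReward_congr {S S' X : Type*} {K : ℕ} (L : Learner S X K)
    (L' : Learner S' X K)
    (h : ∀ l x, L.predict (L.stateAfter l) x = L'.predict (L'.stateAfter l) x)
    (x : ℕ → X) (r : ℕ → Fin K → ℝ) (T : ℕ) :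
    L.expectedReward x r T = L'.expectedReward x r T := by
  have key : ∀ n t l, L.expectedFrom x r n t (L.stateAfter l) =
      L'.expectedFrom x r n t (L'.stateAfter l) := by
    intro n
    induction n with
    | zero => intro t l; rfl
    | succ n ih =>
      intro t l
      simp only [Learner.expectedFrom, h]
      refine Finset.sum_congr rfl fun o _ => ?_
      -- The states of the two learners are never compared; they are tracked only through the common
      -- history.
      have := ih (t + 1) (l ++ [(x t, o, rewardOf (r t) o)])
      simp only [Learner.stateAfter, List.foldl_append, List.foldl_cons, List.foldl_nil] at this ⊢
      rw [this]
  exact key T 0 []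

/-! ## Binary trees with lazy multiplication of suffixes

Nodes are numbered as in a heap: the root is `1`, the children of `h` are `2 * h` and `2 * h + 1`,
and the leaves of a tree of depth `d` are `2 ^ d, …, 2 ^ (d + 1) - 1`. The right subtree of `h`
carries the pending factor `R h`, and `V h` is the total weight below `h`, up to the factors that
are pending above `h`. -/

namespace LazyTree

/-- Product of the factors that are pending on the first `n` edges above the node `q`. -/
def pending (R : ℕ → ℝ) (n q : ℕ) : ℝ :=
  ∏ j ∈ Finset.range n, if q / 2 ^ j % 2 = 1 then R (q / 2 ^ (j + 1)) else 1

theorem pending_succ (R : ℕ → ℝ) (n q : ℕ) :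
    pending R (n + 1) q =
      pending R n q * if q / 2 ^ n % 2 = 1 then R (q / 2 ^ (n + 1)) else 1 :=
  Finset.prod_range_succ _ _

theorem pending_congr {R R' : ℕ → ℝ} {n q : ℕ}
    (h : ∀ j < n, R (q / 2 ^ (j + 1)) = R' (q / 2 ^ (j + 1))) : pending R n q = pending R' n q :=
  Finset.prod_congr rfl fun j hj => by rw [h j (Finset.mem_range.1 hj)]

/-- The arrays `V`, `R` represent the leaf weights `a`, which are indexed by the leaf nodes. -/
structure Represents (V R : ℕ → ℝ) (d : ℕ) (a : ℕ → ℝ) : Prop where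
  leaf : ∀ q, 2 ^ d ≤ q → q < 2 ^ (d + 1) → V q * pending R d q = a q
  node : ∀ h, 1 ≤ h → h < 2 ^ d → V h = V (2 * h) + R h * V (2 * h + 1)

theorem div_pow_succ (q n : ℕ) : q / 2 ^ (n + 1) = q / 2 ^ n / 2 := by
  rw [pow_succ, Nat.div_div_eq_div_mul]

theorem ancestor_bounds {d n q : ℕ} (hn : n ≤ d) (h1 : 2 ^ d ≤ q) (h2 : q < 2 ^ (d + 1)) :
    2 ^ (d - n) ≤ q / 2 ^ n ∧ q / 2 ^ n < 2 ^ (d - n + 1) := by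
  constructor
  · rw [Nat.le_div_iff_mul_le (by positivity), ← pow_add]
    rwa [Nat.sub_add_cancel hn]
  · rw [Nat.div_lt_iff_lt_mul (by positivity), ← pow_add]
    rwa [show d - n + 1 + n = d + 1 by omega]

/-- Total of `g` times the weight over the leaves below the node `h` of height `n`, up to the
factors that are pending above `h`. -/
def below (V R : ℕ → ℝ) (d : ℕ) (g : ℕ → ℝ) (n h : ℕ) : ℝ :=
  ∑ q ∈ (Finset.Ico (2 ^ d) (2 ^ (d + 1))).filter (fun q => q / 2 ^ n = h), V q * pending R n q * g q

theorem below_zero {V R : ℕ → ℝ} {d : ℕ} {g : ℕ → ℝ} {h : ℕ} (h1 : 2 ^ d ≤ h)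
    (h2 : h < 2 ^ (d + 1)) : below V R d g 0 h = V h * g h := by
  unfold below
  simp only [pow_zero, Nat.div_one, Finset.filter_eq']
  rw [if_pos (Finset.mem_Ico.2 ⟨h1, h2⟩)]
  simp [pending]

theorem below_succ (V R : ℕ → ℝ) (d : ℕ) (g : ℕ → ℝ) (n h : ℕ) :
    below V R d g (n + 1) h = below V R d g n (2 * h) + R h * below V R d g n (2 * h + 1) := by
  unfold below
  simp only [Finset.sum_filter, Finset.mul_sum, ← Finset.sum_add_distrib]
  refine Finset.sum_congr rfl fun q _ => ?_
  rw [div_pow_succ, pending_succ, div_pow_succ]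
  generalize q / 2 ^ n = p
  by_cases h1 : p / 2 = h
  · rcases Nat.mod_two_eq_zero_or_one p with h2 | h2
    · have e1 : p = 2 * h := by omega
      simp [e1]
    · have e1 : p = 2 * h + 1 := by omega
      have e2 : (2 * h + 1) / 2 = h := by omega
      simp [e1, e2]
      ring
  · have e1 : p ≠ 2 * h := by omega
    have e2 : p ≠ 2 * h + 1 := by omega
    simp [h1, e1, e2]

theorem below_congr {V R : ℕ → ℝ} {d n h : ℕ} {g g' : ℕ → ℝ}
    (H : ∀ q, q / 2 ^ n = h → g q = g' q) : below V R d g n h = below V R d g' n h := by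
  refine Finset.sum_congr rfl fun q hq => ?_
  rw [H q (Finset.mem_filter.1 hq).2]

/-- `below` with `g = 1` satisfies the same recursion as the stored totals, so they agree by
induction on the height. -/
theorem Represents.node_eq_below {V R : ℕ → ℝ} {d : ℕ} {a : ℕ → ℝ} (H : Represents V R d a)
    {n : ℕ} : ∀ {h : ℕ}, n ≤ d → 2 ^ (d - n) ≤ h → h < 2 ^ (d - n + 1) →
      V h = below V R d (fun _ => 1) n h := by
  induction n with
  | zero =>
    intro h _ h1 h2
    rw [below_zero (by simpa using h1) (by simpa using h2), mul_one]
  | succ n ih =>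
    intro h hn h1 h2
    have e : d - n = d - (n + 1) + 1 := by omega
    have e1 : 2 ^ (d - n) = 2 ^ (d - (n + 1)) * 2 := by rw [e, pow_succ]
    have e2 : 2 ^ (d - n + 1) = 2 ^ (d - (n + 1) + 1) * 2 := by rw [e, pow_succ]
    have e3 : 2 ^ (d - (n + 1) + 1) ≤ 2 ^ d := Nat.pow_le_pow_right (by norm_num) (by omega)
    have e4 : 1 ≤ 2 ^ (d - (n + 1)) := Nat.one_le_two_pow
    rw [below_succ, H.node h (by omega) (by omega), ← ih (by omega) (by omega) (by omega),
      ← ih (by omega) (by omega) (by omega)]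

/-- One step of the query for the total weight of the leaves from `q` on: `h` is the current node
and `acc` the part of the total that lies below it. -/
def queryStep (V R : ℕ → ℝ) (h : ℕ) (acc : ℝ) : ℝ :=
  if h % 2 = 0 then acc + R (h / 2) * V (h + 1) else R (h / 2) * acc

/-- The query after `n` steps. -/
def query (V R : ℕ → ℝ) (q : ℕ) : ℕ → ℝ
  | 0 => V q
  | n + 1 => queryStep V R (q / 2 ^ n) (query V R q n)

/-- Invariant of the climb from `q`: the accumulator is the part of the suffix below the current
ancestor. The right sibling of a left child lies entirely in the suffix; the left sibling of a right
child lies entirely outside it. -/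
theorem Represents.query_eq_below {V R : ℕ → ℝ} {d : ℕ} {a : ℕ → ℝ} (H : Represents V R d a)
    {q : ℕ} (h1 : 2 ^ d ≤ q) (h2 : q < 2 ^ (d + 1)) (n : ℕ) (hn : n ≤ d) :
    query V R q n = below V R d (fun q' => if q ≤ q' then 1 else 0) n (q / 2 ^ n) := by
  induction n with
  | zero => rw [pow_zero, Nat.div_one, below_zero h1 h2]; simp [query]
  | succ n ih =>
    have hb := ancestor_bounds (n := n) (by omega) h1 h2
    rw [query, queryStep, ih (by omega), below_succ, div_pow_succ]
    set p := q / 2 ^ n with hp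
    have e : d - n = d - (n + 1) + 1 := by omega
    have e1 : 2 ^ (d - n) = 2 ^ (d - (n + 1)) * 2 := by rw [e, pow_succ]
    have e2 : 2 ^ (d - n + 1) = 2 ^ (d - (n + 1) + 1) * 2 := by rw [e, pow_succ]
    split_ifs with hpar
    · rw [H.node_eq_below (n := n) (h := p + 1) (by omega) (by omega) (by omega),
        show 2 * (p / 2) = p by omega]
      congr 2
      refine below_congr fun q' hq' => ?_
      rw [if_pos]
      by_contra hlt
      have := Nat.div_le_div_right (c := 2 ^ n) (not_le.1 hlt).le
      omega
    · rw [show 2 * (p / 2) + 1 = p by omega,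
        show below V R d (fun q' => if q ≤ q' then 1 else 0) n (2 * (p / 2)) =
          below V R d (fun _ => 0) n (2 * (p / 2)) from below_congr fun q' hq' => by
            rw [if_neg]
            intro hle
            have := Nat.div_le_div_right (c := 2 ^ n) hle
            omega]
      simp [below]

theorem Represents.query_eq {V R : ℕ → ℝ} {d : ℕ} {a : ℕ → ℝ} (H : Represents V R d a)
    {q : ℕ} (h1 : 2 ^ d ≤ q) (h2 : q < 2 ^ (d + 1)) :
    query V R q d = ∑ q' ∈ Finset.Ico (2 ^ d) (2 ^ (d + 1)), if q ≤ q' then a q' else 0 := by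
  have hroot : ∀ q', 2 ^ d ≤ q' → q' < 2 ^ (d + 1) → q' / 2 ^ d = 1 := fun q' h1 h2 => by
    have := ancestor_bounds le_rfl h1 h2
    simp at this
    omega
  rw [H.query_eq_below h1 h2 d le_rfl, hroot q h1 h2]
  unfold below
  rw [Finset.filter_true_of_mem fun q' hq' => hroot q' (Finset.mem_Ico.1 hq').1
    (Finset.mem_Ico.1 hq').2]
  refine Finset.sum_congr rfl fun q' hq' => ?_
  rw [H.leaf q' (Finset.mem_Ico.1 hq').1 (Finset.mem_Ico.1 hq').2]
  simp

/-- Pending factors after the first `n` steps of the multiplication by `f` of the leaves from `q`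
on. -/
def scaleFactors (R : ℕ → ℝ) (f : ℝ) (q : ℕ) : ℕ → ℕ → ℝ
  | 0 => R
  | n + 1 =>
    if q / 2 ^ n % 2 = 0 then
      Function.update (scaleFactors R f q n) (q / 2 ^ n / 2)
        (scaleFactors R f q n (q / 2 ^ n / 2) * f)
    else scaleFactors R f q n

/-- Totals after the first `n` steps of the multiplication by `f` of the leaves from `q` on. -/
def scaleTotals (V R : ℕ → ℝ) (f : ℝ) (q : ℕ) : ℕ → ℕ → ℝ
  | 0 => Function.update V q (V q * f)
  | n + 1 =>
    Function.update (scaleTotals V R f q n) (q / 2 ^ n / 2)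
      (scaleTotals V R f q n (2 * (q / 2 ^ n / 2)) +
        scaleFactors R f q (n + 1) (q / 2 ^ n / 2) *
          scaleTotals V R f q n (2 * (q / 2 ^ n / 2) + 1))

theorem scaleFactors_succ_of_ne {R : ℕ → ℝ} {f : ℝ} {q n h : ℕ} (hh : h ≠ q / 2 ^ n / 2) :
    scaleFactors R f q (n + 1) h = scaleFactors R f q n h := by
  rw [scaleFactors]
  split_ifs
  · rw [Function.update_of_ne hh]
  · rfl

/-- The climb has so far changed only ancestors of height at most `n`, whose heap numbers are at
least `2 ^ (d - n)`. -/
theorem scaleFactors_of_lt {R : ℕ → ℝ} {f : ℝ} {d q : ℕ} (h1 : 2 ^ d ≤ q) (h2 : q < 2 ^ (d + 1))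
    {n : ℕ} : n ≤ d → ∀ {h : ℕ}, h < 2 ^ (d - n) → scaleFactors R f q n h = R h := by
  induction n with
  | zero => intros; rfl
  | succ n ih =>
    intro hn h hh
    have hb := ancestor_bounds hn h1 h2
    rw [div_pow_succ] at hb
    have : 2 ^ (d - (n + 1)) ≤ 2 ^ (d - n) := Nat.pow_le_pow_right (by norm_num) (by omega)
    rw [scaleFactors_succ_of_ne (by omega), ih (by omega) (by omega)]

theorem scaleTotals_of_leaf {V R : ℕ → ℝ} {f : ℝ} {d q : ℕ} (h1 : 2 ^ d ≤ q)
    (h2 : q < 2 ^ (d + 1)) {n : ℕ} : n ≤ d → ∀ {q' : ℕ}, 2 ^ d ≤ q' →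
      scaleTotals V R f q n q' = V q' * if q' = q then f else 1 := by
  induction n with
  | zero =>
    intro _ q' _
    rw [scaleTotals]
    by_cases h : q' = q
    · subst h; simp
    · simp [h]
  | succ n ih =>
    intro hn q' hq'
    have hb := ancestor_bounds hn h1 h2
    rw [div_pow_succ] at hb
    have : 2 ^ (d - (n + 1) + 1) ≤ 2 ^ d := Nat.pow_le_pow_right (by norm_num) (by omega)
    rw [scaleTotals, Function.update_of_ne (by omega), ih (by omega) hq']

/-- The suffix consists of `q` itself and the right siblings of the left children on the path from
`q` to the root. Each piece receives `f` exactly once, directly at `q` or through the right edge of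
the parent. -/
theorem pending_scaleFactors {V R : ℕ → ℝ} {f : ℝ} {d q : ℕ} (h1 : 2 ^ d ≤ q)
    (h2 : q < 2 ^ (d + 1)) {q' : ℕ} (h1' : 2 ^ d ≤ q') (h2' : q' < 2 ^ (d + 1)) {n : ℕ}
    (hn : n ≤ d) :
    (V q' * if q' = q then f else 1) * pending (scaleFactors R f q n) n q' =
      V q' * pending R n q' * if q' / 2 ^ n = q / 2 ^ n ∧ q ≤ q' then f else 1 := by
  induction n with
  | zero =>
    simp only [pending, Finset.range_zero, Finset.prod_empty, pow_zero, Nat.div_one, mul_one]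
    congr 1
    refine if_congr ?_ rfl rfl
    exact ⟨fun h => ⟨h, h.ge⟩, fun h => h.1⟩
  | succ n ih =>
    have hb := ancestor_bounds (n := n + 1) hn h1 h2
    have hb' := ancestor_bounds (n := n + 1) hn h1' h2'
    have hmono : q / 2 ^ n < q' / 2 ^ n → q ≤ q' := fun h => by
      by_contra hlt
      have := Nat.div_le_div_right (c := 2 ^ n) (not_le.1 hlt).le
      omega
    have hmono' : q ≤ q' → q / 2 ^ n ≤ q' / 2 ^ n := fun h => Nat.div_le_div_right h
    -- The new step changes a factor stored at height `n + 1`, whereas the first `n` edges above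
    -- `q'` use factors stored at heights up to `n`.
    have hlow : pending (scaleFactors R f q (n + 1)) n q' = pending (scaleFactors R f q n) n q' := by
      refine pending_congr fun j hj => scaleFactors_succ_of_ne ?_
      have hj' := ancestor_bounds (n := j + 1) (by omega) h1' h2'
      have : 2 ^ (d - (n + 1) + 1) ≤ 2 ^ (d - (j + 1)) :=
        Nat.pow_le_pow_right (by norm_num) (by omega)
      rw [div_pow_succ q] at hb
      omega
    have hR : scaleFactors R f q n (q' / 2 ^ (n + 1)) = R (q' / 2 ^ (n + 1)) := by
      refine scaleFactors_of_lt h1 h2 (by omega) ?_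
      rw [show d - n = d - (n + 1) + 1 by omega]
      exact hb'.2
    rw [pending_succ, pending_succ, hlow, ← mul_assoc, ← mul_assoc (V q'), ih (by omega), scaleFactors]
    rw [div_pow_succ] at hR ⊢
    rw [div_pow_succ q]
    generalize q / 2 ^ n = p at *
    generalize q' / 2 ^ n = p' at *
    generalize V q' * pending R n q' = c
    -- Under a common parent, a new factor `f` is acquired only if `p` is the left and `p'` the
    -- right child. Under different parents the changed factor is not on the path of `q'`.
    by_cases hsame : p' / 2 = p / 2
    · rcases Nat.mod_two_eq_zero_or_one p with hp | hp <;>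
        rcases Nat.mod_two_eq_zero_or_one p' with hp' | hp'
      · have : p' = p := by omega
        simp [hp, this]
      · have hq : q ≤ q' := hmono (by omega)
        have : p' ≠ p := by omega
        rw [hsame] at hR
        simp [hp, hp', this, hsame, hq, hR]
        ring
      · have hq : ¬ q ≤ q' := fun h => by have := hmono' h; omega
        simp [hp', hq]
      · have : p' = p := by omega
        subst this
        simp only [hp, hR, true_and, if_true, one_ne_zero, if_false]
        ring
    · have hne : p' ≠ p := fun h => hsame (by rw [h])
      simp only [hsame, hne, false_and, if_false, mul_one]
      split_ifs
      · rw [Function.update_of_ne hsame, hR]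
      · rw [hR]
      · rfl

theorem Represents.scale {V R : ℕ → ℝ} {d : ℕ} {a : ℕ → ℝ} (H : Represents V R d a) (f : ℝ)
    {q : ℕ} (h1 : 2 ^ d ≤ q) (h2 : q < 2 ^ (d + 1)) :
    Represents (scaleTotals V R f q d) (scaleFactors R f q d) d
      (fun q' => a q' * if q ≤ q' then f else 1) := by
  -- After `n` steps the sum rule can fail only at the parent of `q / 2 ^ n`, which the next step
  -- recomputes. For `n = d` the exception is vacuous, since the root has no parent.
  have node : ∀ n ≤ d, ∀ h, 1 ≤ h → h < 2 ^ d → (h < 2 ^ (d - n) → 2 * h ≠ q / 2 ^ n ∧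
      2 * h + 1 ≠ q / 2 ^ n) →
      scaleTotals V R f q n h = scaleTotals V R f q n (2 * h) +
        scaleFactors R f q n h * scaleTotals V R f q n (2 * h + 1) := by
    intro n
    induction n with
    | zero =>
      intro _ h h3 h4 h5
      have h5 := h5 (by simpa using h4)
      simp only [pow_zero, Nat.div_one] at h5
      rw [scaleTotals, scaleFactors, Function.update_of_ne (by omega),
        Function.update_of_ne h5.1, Function.update_of_ne h5.2, H.node h h3 h4]
    | succ n ih =>
      intro hn h h3 h4 h5
      have hb := ancestor_bounds (n := n) (by omega) h1 h2
      have e1 : 2 ^ (d - n) = 2 ^ (d - (n + 1)) * 2 := by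
        rw [← pow_succ]; congr 1; omega
      have e2 : 2 ^ (d - n + 1) = 2 ^ (d - n) * 2 := by rw [pow_succ]
      rw [scaleTotals]
      by_cases hh : h = q / 2 ^ n / 2
      · rw [hh, Function.update_self, Function.update_of_ne (by omega),
          Function.update_of_ne (by omega)]
      · rw [div_pow_succ] at h5
        have h6 : 2 * h ≠ q / 2 ^ n / 2 ∧ 2 * h + 1 ≠ q / 2 ^ n / 2 := by
          by_cases h7 : h < 2 ^ (d - (n + 1))
          · exact h5 h7
          · omega
        rw [Function.update_of_ne hh, Function.update_of_ne h6.1, Function.update_of_ne h6.2,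
          scaleFactors_succ_of_ne hh]
        exact ih (by omega) h h3 h4 fun h7 => by omega
  refine ⟨fun q' h1' h2' => ?_, fun h h3 h4 => node d le_rfl h h3 h4 fun h5 => ?_⟩
  · rw [scaleTotals_of_leaf h1 h2 le_rfl h1', pending_scaleFactors h1 h2 h1' h2' le_rfl,
      H.leaf q' h1' h2']
    have hb := ancestor_bounds le_rfl h1 h2
    have hb' := ancestor_bounds le_rfl h1' h2'
    simp only [Nat.sub_self, pow_zero, zero_add, pow_one] at hb hb'
    rw [show q' / 2 ^ d = q / 2 ^ d by omega]
    simp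
  · simp at h5; omega

/-- Without pending factors the leaf weights are stored as they are. -/
theorem represents_of_factors_eq_one {V R : ℕ → ℝ} {d : ℕ} (hR : ∀ h < 2 ^ d, R h = 1)
    (hV : ∀ h, 1 ≤ h → h < 2 ^ d → V h = V (2 * h) + R h * V (2 * h + 1)) :
    Represents V R d V := by
  refine ⟨fun q h1 h2 => ?_, hV⟩
  rw [pending, Finset.prod_eq_one, mul_one]
  intro j hj
  have hb := ancestor_bounds (n := j + 1) (Finset.mem_range.1 hj) h1 h2
  have : 2 ^ (d - (j + 1) + 1) ≤ 2 ^ d :=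
    Nat.pow_le_pow_right (by norm_num) (by have := Finset.mem_range.1 hj; omega)
  split_ifs
  · exact hR _ (by omega)
  · rfl

end LazyTree

/-! ## Reasoning about programs -/

namespace Mem

@[simp] theorem setNat_real (m : Mem) (a i j k v : ℕ) : (m.setNat a i j k v).real = m.real := rfl

@[simp] theorem setReal_nat (m : Mem) (a i j k : ℕ) (v : ℝ) : (m.setReal a i j k v).nat = m.nat :=
  rfl

@[simp] theorem setNat_nat_of_ne (m : Mem) {a a' : ℕ} (i j k v : ℕ) (h : a' ≠ a) :
    (m.setNat a i j k v).nat a' = m.nat a' := by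
  funext i' j' k'
  simp [setNat, h]

@[simp] theorem setReal_real_of_ne (m : Mem) {a a' : ℕ} (i j k : ℕ) (v : ℝ) (h : a' ≠ a) :
    (m.setReal a i j k v).real a' = m.real a' := by
  funext i' j' k'
  simp [setReal, h]

@[simp] theorem setNat_nat_self (m : Mem) (a i j k v : ℕ) :
    (m.setNat a i j k v).nat a i j k = v := by
  simp [setNat]

@[simp] theorem setReal_row (m : Mem) (a i j k : ℕ) (v : ℝ) :
    (m.setReal a i j k v).real a i j = Function.update (m.real a i j) k v := by
  funext k'
  by_cases h : k' = k
  · subst h; simp [setReal]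
  · simp [setReal, h]

theorem setReal_row_of_ne (m : Mem) (a : ℕ) {i j i' j' : ℕ} (k : ℕ) (v : ℝ)
    (h : i' ≠ i ∨ j' ≠ j) : (m.setReal a i j k v).real a i' j' = m.real a i' j' := by
  funext k'
  simp only [setReal]
  rw [if_neg]
  omega

theorem setReal_column (m : Mem) (a i i' : ℕ) (v : ℝ) :
    (m.setReal a i 0 0 v).real a i' 0 0 = if i' = i then v else m.real a i' 0 0 := by
  simp [setReal]

theorem setNat_entry (m : Mem) (a i j i' j' v : ℕ) :
    (m.setNat a i j 0 v).nat a i' j' 0 = if i' = i ∧ j' = j then v else m.nat a i' j' 0 := by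
  simp [setNat]

end Mem

namespace Cmd

/-- The command does not write to the natural-number array `a`. -/
def AvoidsNat (a : ℕ) : Cmd → Prop
  | skip => True
  | setNat arr _ _ _ _ => a ≠ arr
  | setReal _ _ _ _ _ => True
  | seq c d => c.AvoidsNat a ∧ d.AvoidsNat a
  | ite _ c d => c.AvoidsNat a ∧ d.AvoidsNat a
  | loop v _ c => a ≠ v ∧ c.AvoidsNat a

/-- The command does not write to the real array `a`. -/
def AvoidsReal (a : ℕ) : Cmd → Prop
  | skip => True
  | setNat _ _ _ _ _ => True
  | setReal arr _ _ _ _ => a ≠ arr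
  | seq c d => c.AvoidsReal a ∧ d.AvoidsReal a
  | ite _ c d => c.AvoidsReal a ∧ d.AvoidsReal a
  | loop _ _ c => c.AvoidsReal a

theorem exec_seq (c d : Cmd) (m : Mem) : (seq c d).exec m = d.exec (c.exec m) := rfl

theorem exec_ite_pos {b : Test} {c d : Cmd} {m : Mem} (h : b.holds m) :
    (ite b c d).exec m = c.exec m := by
  rw [exec, if_pos h]

theorem exec_ite_neg {b : Test} {c d : Cmd} {m : Mem} (h : ¬ b.holds m) :
    (ite b c d).exec m = d.exec m := by
  rw [exec, if_neg h]

/-- Invariant rule for loops. The bound is evaluated in the entry memory, so the body may change the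
cells it was read from. -/
theorem exec_loop_induction {v : ℕ} {n : NExp} {c : Cmd} (m : Mem) (P : ℕ → Mem → Prop)
    (h0 : P 0 m)
    (hs : ∀ i < n.eval m, ∀ m', P i m' → P (i + 1) (c.exec (m'.setNat v 0 0 0 i))) :
    P (n.eval m) ((loop v n c).exec m) := by
  have : ∀ i ≤ n.eval m, P i (iter c.exec v m i) := by
    intro i
    induction i with
    | zero => intro _; exact h0
    | succ i ih => intro hi; exact hs i hi _ (ih (by omega))
  exact this _ le_rfl

theorem nat_of_avoids {a : ℕ} {c : Cmd} : c.AvoidsNat a → ∀ m, (c.exec m).nat a = m.nat a := by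
  induction c with
  | skip => intros; rfl
  | setNat arr i j k e => intro h m; exact Mem.setNat_nat_of_ne _ _ _ _ _ h
  | setReal arr i j k e => intros; rfl
  | seq c d hc hd => intro h m; rw [exec, hd h.2, hc h.1]
  | ite b c d hc hd =>
    intro h m
    rw [exec]
    split_ifs
    · exact hc h.1 m
    · exact hd h.2 m
  | loop v n c hc =>
    intro h m
    refine exec_loop_induction m (fun _ m' => m'.nat a = m.nat a) rfl fun i _ m' hm' => ?_
    rw [hc h.2, Mem.setNat_nat_of_ne _ _ _ _ _ h.1, hm']

theorem real_of_avoids {a : ℕ} {c : Cmd} :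
    c.AvoidsReal a → ∀ m, (c.exec m).real a = m.real a := by
  induction c with
  | skip => intros; rfl
  | setNat arr i j k e => intros; rfl
  | setReal arr i j k e => intro h m; exact Mem.setReal_real_of_ne _ _ _ _ _ h
  | seq c d hc hd => intro h m; rw [exec, hd h.2, hc h.1]
  | ite b c d hc hd =>
    intro h m
    rw [exec]
    split_ifs
    · exact hc h.1 m
    · exact hd h.2 m
  | loop v n c hc =>
    intro h m
    refine exec_loop_induction m (fun _ m' => m'.real a = m.real a) rfl fun i _ m' hm' => ?_
    rw [hc h, Mem.setNat_real, hm']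

/-- Every loop of the command is bounded by a natural-number expression that only depends on
arrays in `A`. -/
def LoopsOver (A : Finset ℕ) : Cmd → Prop
  | skip => True
  | setNat _ _ _ _ _ => True
  | setReal _ _ _ _ _ => True
  | seq c d => c.LoopsOver A ∧ d.LoopsOver A
  | ite _ c d => c.LoopsOver A ∧ d.LoopsOver A
  | loop _ n c => (∀ m m' : Mem, (∀ a ∈ A, m.nat a = m'.nat a) → n.eval m = n.eval m') ∧
      c.LoopsOver A

/-- Time bound for commands that do not change the bounds of their loops. -/
def staticTime (m : Mem) : Cmd → ℕ
  | skip => 1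
  | setNat _ i j k e => i.cost + j.cost + k.cost + e.cost + 1
  | setReal _ i j k e => i.cost + j.cost + k.cost + e.cost + 1
  | seq c d => c.staticTime m + d.staticTime m + 1
  | ite b c d => b.cost + (c.staticTime m + d.staticTime m) + 1
  | loop _ n c => n.cost + 1 + n.eval m * (c.staticTime m + 1)

/-- The arrays that determine the loop bounds are never written, so all bounds keep their initial
values. Charging both branches of a conditional makes the time bound a formula that `ring` can
normalise. -/
theorem time_le_staticTime {A : Finset ℕ} {m₀ : Mem} {c : Cmd} :
    c.LoopsOver A → (∀ a ∈ A, c.AvoidsNat a) → ∀ m, (∀ a ∈ A, m.nat a = m₀.nat a) →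
      c.time m ≤ c.staticTime m₀ := by
  induction c with
  | skip => intros; exact le_rfl
  | setNat arr i j k e => intros; exact le_rfl
  | setReal arr i j k e => intros; exact le_rfl
  | seq c d hc hd =>
    intro h ha m hm
    have h1 := hc h.1 (fun a haA => (ha a haA).1) m hm
    have h2 := hd h.2 (fun a haA => (ha a haA).2) (c.exec m) fun a haA => by
      rw [nat_of_avoids (ha a haA).1, hm a haA]
    simp only [time, staticTime]
    omega
  | ite b c d hc hd =>
    intro h ha m hm
    have h1 := hc h.1 (fun a haA => (ha a haA).1) m hm
    have h2 := hd h.2 (fun a haA => (ha a haA).2) m hm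
    simp only [time, staticTime]
    split_ifs <;> omega
  | loop v n c hc =>
    intro h ha m hm
    have hinv : ∀ i, ∀ a ∈ A, (iter c.exec v m i).nat a = m₀.nat a := by
      intro i a haA
      induction i with
      | zero => exact hm a haA
      | succ i ih =>
        rw [iter, nat_of_avoids (ha a haA).2, Mem.setNat_nat_of_ne _ _ _ _ _ (ha a haA).1, ih]
    simp only [time, staticTime]
    rw [h.1 m m₀ hm]
    refine Nat.add_le_add_left ?_ _
    refine (Finset.sum_le_card_nsmul _ _ (c.staticTime m₀ + 1) fun i _ => ?_).trans_eq (by simp)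
    refine Nat.add_le_add_right (hc h.2 (fun a haA => (ha a haA).2) _ fun a haA => ?_) 1
    rw [Mem.setNat_nat_of_ne _ _ _ _ _ (ha a haA).1, hinv i a haA]

end Cmd

/-! ## The program

Natural-number arrays: `6` number of leaves of each tree, `7` depth, `8` ranks, `9` tree centre,
`10` action, `11` loop counter, `12` and `13` nodes. Real arrays: `3` totals, `4` pending factors,
`5` accumulator, `6` scale, `7` learning rate, `8` factors of the actions. -/

namespace Prog

open Cmd

/-- A natural-number scalar. -/
def cell (a : ℕ) : NExp := .read a (.const 0) (.const 0) (.const 0)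

/-- A real scalar. -/
def rcell (a : ℕ) : RExp := .read a (.const 0) (.const 0) (.const 0)

/-- Entry of a one-dimensional real array. -/
def entry (a : ℕ) (i : NExp) : RExp := .read a i (.const 0) (.const 0)

/-- Assignment to a natural-number scalar. -/
def put (a : ℕ) (e : NExp) : Cmd := .setNat a (.const 0) (.const 0) (.const 0) e

/-- Assignment to a real scalar. -/
def rput (a : ℕ) (e : RExp) : Cmd := .setReal a (.const 0) (.const 0) (.const 0) e

/-- Assignment to an entry of a one-dimensional real array. -/
def eput (a : ℕ) (i : NExp) (e : RExp) : Cmd := .setReal a i (.const 0) (.const 0) e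

/-- Entry of the current tree. -/
def tree (a : ℕ) (h : NExp) : RExp := .read a (cell 9) (cell 10) h

/-- Assignment to an entry of the current tree. -/
def tput (a : ℕ) (h : NExp) (e : RExp) : Cmd := .setReal a (cell 9) (cell 10) h e

/-- Left child of the current node. -/
def left : NExp := .plus (cell 12) (cell 12)

/-- Right child of the current node. -/
def right : NExp := .plus left (.const 1)

/-- Leaf node of the point `i` in the current tree. -/
def leafOf (i : NExp) : NExp := .plus (cell 6) (.read 8 (cell 9) i (.const 0))

/-- Recomputes the total of the current node. -/
def refresh : Cmd := tput 3 (cell 12) (.plus (tree 3 left) (.times (tree 4 (cell 12)) (tree 3 right)))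

/-- Moves to the parent and branches on whether the old node was a left child. -/
def ascend (c d : Cmd) : Cmd :=
  .seq (put 13 (cell 12)) (.seq (put 12 (.half (cell 12))) (.ite (.natLe (cell 13) left) c d))

/-- Puts the total of the leaves of the current tree from the current context on into the
accumulator. -/
def query : Cmd :=
  .seq (put 12 (leafOf (cell 4)))
    (.seq (rput 5 (tree 3 (cell 12)))
      (.loop 11 (cell 7)
        (ascend (rput 5 (.plus (rcell 5) (.times (tree 4 (cell 12)) (tree 3 right))))
          (rput 5 (.times (tree 4 (cell 12)) (rcell 5))))))

/-- Multiplies these leaves by the factor of the current action. -/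
def rescale : Cmd :=
  .seq (put 12 (leafOf (cell 4)))
    (.seq (tput 3 (cell 12) (.times (tree 3 (cell 12)) (entry 8 (cell 10))))
      (.loop 11 (cell 7)
        (.seq (ascend (tput 4 (cell 12) (.times (tree 4 (cell 12)) (entry 8 (cell 10)))) .skip)
          refresh)))

/-- Runs the command for every centre and action. -/
def forTrees (c : Cmd) : Cmd := .loop 9 (cell 0) (.loop 10 (cell 1) c)

/-- Adds up the queries over all centres, for the current action. -/
def sumQueries : Cmd :=
  .seq (eput 1 (cell 10) (.ofNat (.const 0)))
    (.seq (.loop 9 (cell 0)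
        (.seq query (eput 1 (cell 10) (.plus (entry 1 (cell 10)) (rcell 5)))))
      (rput 6 (.plus (rcell 6) (entry 1 (cell 10)))))

/-- The routine that computes the stochastic action. -/
def choose : Cmd :=
  .seq (rput 6 (.ofNat (.const 0)))
    (.seq (.loop 10 (cell 1) sumQueries)
      (.seq (.ite (.realLe (rcell 6) (.ofNat (.const 1))) (rput 6 (.ofNat (.const 1))) .skip)
        (.loop 10 (cell 1) (eput 1 (cell 10) (.divide (entry 1 (cell 10)) (rcell 6))))))

/-- Computes the factors of the actions. -/
def factors : Cmd :=
  .seq (.loop 10 (cell 1) (eput 8 (cell 10) (.divide (.exp (rcell 7)) (rcell 6))))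
    (eput 8 (cell 5) (.divide (.exp (.times (rcell 7) (.minus (.ofNat (.const 1))
      (.divide (.minus (.ofNat (.const 1)) (rcell 2)) (entry 1 (cell 5)))))) (rcell 6)))

/-- The routine that processes the observed reward. -/
def learn : Cmd := .seq factors (forTrees rescale)

/-- Computes the number of leaves and the depth of the trees. -/
def sizes : Cmd :=
  .seq (put 6 (.const 1))
    (.loop 9 (cell 0) (.ite (.natLe (cell 0) (cell 6)) .skip
      (.seq (put 6 (.plus (cell 6) (cell 6))) (put 7 (.plus (cell 7) (.const 1))))))

/-- Computes the ranks of the points around every centre. -/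
def ranks : Cmd :=
  .loop 9 (cell 0) (.loop 10 (cell 0) (.loop 11 (cell 0)
    (.ite (.realLe (.read 0 (cell 9) (cell 10) (.const 0)) (.read 0 (cell 9) (cell 11) (.const 0)))
      .skip
      (.setNat 8 (cell 9) (cell 10) (.const 0)
        (.plus (.read 8 (cell 9) (cell 10) (.const 0)) (.const 1))))))

def fillLeaves : Cmd :=
  .loop 11 (cell 0) (tput 3 (leafOf (cell 11)) (.plus (tree 3 (leafOf (cell 11))) (rcell 5)))

def fillFactors : Cmd := .loop 11 (cell 6) (tput 4 (cell 11) (.ofNat (.const 1)))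

def fillNodes : Cmd :=
  .loop 11 (cell 6) (.seq (put 12 (.minus (cell 6) (.plus (cell 11) (.const 1)))) refresh)

def initTree : Cmd := .seq fillLeaves (.seq fillFactors fillNodes)

def initialWeight : Cmd :=
  rput 5 (.divide (.ofNat (cell 2)) (.times (.ofNat (cell 1))
    (.times (.ofNat (cell 0)) (.ofNat (cell 0)))))

def learningRate : Cmd :=
  .seq (rput 6 (.ofNat (cell 0)))
    (.seq (.ite (.realLe (rcell 6) (.divide (.ofNat (cell 1)) (.ofNat (cell 2))))
        (rput 6 (.divide (.ofNat (cell 1)) (.ofNat (cell 2)))) .skip)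
      (.seq (rput 7 (.sqrt (.divide
          (.times (.ofNat (.const 3)) (.times (.ofNat (cell 2)) (.log (rcell 6))))
          (.times (.ofNat (.const 2)) (.times (.ofNat (cell 1)) (.ofNat (cell 3)))))))
        (.ite (.realLe (rcell 7) (.divide (.ofNat (.const 1)) (.ofNat (.const 2)))) .skip
          (rput 7 (.divide (.ofNat (.const 1)) (.ofNat (.const 2)))))))

def prepare : Cmd :=
  .seq sizes (.seq ranks (.seq initialWeight (.seq (forTrees initTree) learningRate)))

/-- Every write to the arrays `3` and `4` goes to the current tree, which does not change. -/
def TreeLocal : Cmd → Prop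
  | .skip => True
  | .setNat arr _ _ _ _ => arr ≠ 9 ∧ arr ≠ 10
  | .setReal arr i j _ _ => arr = 3 ∨ arr = 4 → i = cell 9 ∧ j = cell 10
  | .seq c d => TreeLocal c ∧ TreeLocal d
  | .ite _ c d => TreeLocal c ∧ TreeLocal d
  | .loop v _ c => (v ≠ 9 ∧ v ≠ 10) ∧ TreeLocal c

theorem TreeLocal.avoids {c : Cmd} : TreeLocal c → c.AvoidsNat 9 ∧ c.AvoidsNat 10 := by
  induction c with
  | skip => intro _; exact ⟨trivial, trivial⟩
  | setNat arr i j k e => intro h; exact ⟨h.1.symm, h.2.symm⟩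
  | setReal arr i j k e => intro _; exact ⟨trivial, trivial⟩
  | seq c d hc hd => intro h; exact ⟨⟨(hc h.1).1, (hd h.2).1⟩, (hc h.1).2, (hd h.2).2⟩
  | ite b c d hc hd => intro h; exact ⟨⟨(hc h.1).1, (hd h.2).1⟩, (hc h.1).2, (hd h.2).2⟩
  | loop v n c hc => intro h; exact ⟨⟨h.1.1.symm, (hc h.2).1⟩, h.1.2.symm, (hc h.2).2⟩

@[simp] theorem cell_eval (a : ℕ) (m : Mem) : (cell a).eval m = m.nat a 0 0 0 := rfl

@[simp] theorem rcell_eval (a : ℕ) (m : Mem) : (rcell a).eval m = m.real a 0 0 0 := rfl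

theorem TreeLocal.row_eq {c : Cmd} {a : ℕ} (ha : a = 3 ∨ a = 4) : TreeLocal c → ∀ (m : Mem)
    (z k : ℕ), z ≠ m.nat 9 0 0 0 ∨ k ≠ m.nat 10 0 0 0 → (c.exec m).real a z k = m.real a z k := by
  induction c with
  | skip => intros; rfl
  | setNat arr i j k e => intros; rfl
  | setReal arr i j k e =>
    intro h m z k' hne
    rw [exec]
    by_cases harr : a = arr
    · subst harr
      obtain ⟨rfl, rfl⟩ := h ha
      exact Mem.setReal_row_of_ne _ _ _ _ hne
    · rw [Mem.setReal_real_of_ne _ _ _ _ _ harr]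
  | seq c d hc hd =>
    intro h m z k hne
    have h9 := nat_of_avoids h.1.avoids.1 m
    have h10 := nat_of_avoids h.1.avoids.2 m
    rw [exec, hd h.2 _ _ _ (by rwa [h9, h10]), hc h.1 _ _ _ hne]
  | ite b c d hc hd =>
    intro h m z k hne
    rw [exec]
    split_ifs
    · exact hc h.1 m z k hne
    · exact hd h.2 m z k hne
  | loop v n c hc =>
    intro h m z k hne
    refine (exec_loop_induction m (fun _ m' => m'.real a z k = m.real a z k ∧
      m'.nat 9 = m.nat 9 ∧ m'.nat 10 = m.nat 10) ⟨rfl, rfl, rfl⟩ fun i _ m' hm' => ?_).1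
    have h9 : (m'.setNat v 0 0 0 i).nat 9 = m.nat 9 := by
      rw [Mem.setNat_nat_of_ne _ _ _ _ _ h.1.1.symm, hm'.2.1]
    have h10 : (m'.setNat v 0 0 0 i).nat 10 = m.nat 10 := by
      rw [Mem.setNat_nat_of_ne _ _ _ _ _ h.1.2.symm, hm'.2.2]
    refine ⟨?_, ?_, ?_⟩
    · rw [hc h.2 _ _ _ (by rwa [h9, h10]), Mem.setNat_real, hm'.1]
    · rw [nat_of_avoids h.2.avoids.1, h9]
    · rw [nat_of_avoids h.2.avoids.2, h10]

/-- Reduces a sweep over all trees to one tree: in lexicographic order, trees not yet visited are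
unchanged and visited ones satisfy `Done`. Array `1` must be preserved because the inner bound is
read again for every centre. -/
theorem exec_forTrees {c : Cmd} (hc : TreeLocal c) (h1 : c.AvoidsNat 1)
    (m : Mem) (Done : ℕ → ℕ → (ℕ → ℝ) → (ℕ → ℝ) → Prop)
    (step : ∀ z < m.nat 0 0 0 0, ∀ k < m.nat 1 0 0 0, ∀ m' : Mem,
      (∀ a, a ≠ 9 → a ≠ 10 → c.AvoidsNat a → m'.nat a = m.nat a) →
      (∀ a, c.AvoidsReal a → m'.real a = m.real a) →
      m'.nat 9 0 0 0 = z → m'.nat 10 0 0 0 = k →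
      m'.real 3 z k = m.real 3 z k → m'.real 4 z k = m.real 4 z k →
      Done z k ((c.exec m').real 3 z k) ((c.exec m').real 4 z k)) :
    ∀ z < m.nat 0 0 0 0, ∀ k < m.nat 1 0 0 0,
      Done z k (((forTrees c).exec m).real 3 z k) (((forTrees c).exec m).real 4 z k) := by
  let Frame : Mem → Prop := fun m' =>
    (∀ a, a ≠ 9 → a ≠ 10 → c.AvoidsNat a → m'.nat a = m.nat a) ∧
      (∀ a, c.AvoidsReal a → m'.real a = m.real a)
  have frame_step : ∀ {m' : Mem} (v : ℕ), Frame m' → Frame (c.exec (m'.setNat 10 0 0 0 v)) := by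
    intro m' v hm'
    refine ⟨fun a h9 h10 ha => ?_, fun a ha => ?_⟩
    · rw [nat_of_avoids ha, Mem.setNat_nat_of_ne _ _ _ _ _ h10, hm'.1 a h9 h10 ha]
    · rw [real_of_avoids ha, Mem.setNat_real, hm'.2 a ha]
  let State : ℕ → ℕ → Mem → Prop := fun z k m' => Frame m' ∧
    (∀ z' k', z < z' ∨ (z' = z ∧ k ≤ k') →
      m'.real 3 z' k' = m.real 3 z' k' ∧ m'.real 4 z' k' = m.real 4 z' k') ∧
    ∀ z' k', z' < m.nat 0 0 0 0 → k' < m.nat 1 0 0 0 → z' < z ∨ (z' = z ∧ k' < k) →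
      Done z' k' (m'.real 3 z' k') (m'.real 4 z' k')
  have main : State (m.nat 0 0 0 0) 0 ((forTrees c).exec m) := by
    refine exec_loop_induction m (fun z => State z 0) ⟨⟨fun _ _ _ _ => rfl, fun _ _ => rfl⟩,
      fun _ _ _ => ⟨rfl, rfl⟩, fun z' k' _ _ h => by omega⟩ fun z hz m' hm' => ?_
    have e1 : (cell 1).eval (m'.setNat 9 0 0 0 z) = m.nat 1 0 0 0 := by
      rw [cell_eval, Mem.setNat_nat_of_ne _ _ _ _ _ (by norm_num),
        hm'.1.1 1 (by norm_num) (by norm_num) h1]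
    have inner := exec_loop_induction (v := 10) (n := cell 1) (c := c) (m'.setNat 9 0 0 0 z)
      (fun k m'' => State z k m'' ∧ m''.nat 9 0 0 0 = z) ⟨⟨⟨fun a h9 h10 ha => by
        rw [Mem.setNat_nat_of_ne _ _ _ _ _ h9, hm'.1.1 a h9 h10 ha], hm'.1.2⟩, hm'.2⟩,
        Mem.setNat_nat_self _ _ _ _ _ _⟩ ?_
    · rw [e1] at inner
      refine ⟨inner.1.1, fun z' k' h => inner.1.2.1 z' k' (by omega), fun z' k' hz' hk' h =>
        inner.1.2.2 z' k' hz' hk' (by omega)⟩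
    · intro k hk m'' hm''
      rw [e1] at hk
      obtain ⟨⟨hF, hT, hD⟩, h9⟩ := hm''
      have h9' : (m''.setNat 10 0 0 0 k).nat 9 0 0 0 = z := by
        rw [Mem.setNat_nat_of_ne _ _ _ _ _ (by norm_num), h9]
      have h10' : (m''.setNat 10 0 0 0 k).nat 10 0 0 0 = k := Mem.setNat_nat_self _ _ _ _ _ _
      have row : ∀ z' k', z' ≠ z ∨ k' ≠ k →
          (c.exec (m''.setNat 10 0 0 0 k)).real 3 z' k' = m''.real 3 z' k' ∧
          (c.exec (m''.setNat 10 0 0 0 k)).real 4 z' k' = m''.real 4 z' k' := fun z' k' h =>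
        ⟨hc.row_eq (Or.inl rfl) _ z' k' (by rwa [h9', h10']),
          hc.row_eq (Or.inr rfl) _ z' k' (by rwa [h9', h10'])⟩
      refine ⟨⟨frame_step k hF, fun z' k' h => ?_, fun z' k' hz' hk' h => ?_⟩, ?_⟩
      · rw [(row z' k' (by omega)).1, (row z' k' (by omega)).2]
        exact hT z' k' (by omega)
      · by_cases hcur : z' = z ∧ k' = k
        · obtain ⟨rfl, rfl⟩ := hcur
          exact step z' hz' k' hk' _ (fun a ha9 ha10 ha => by
            rw [Mem.setNat_nat_of_ne _ _ _ _ _ ha10, hF.1 a ha9 ha10 ha]) hF.2 h9' h10'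
            (hT z' k' (by omega)).1 (hT z' k' (by omega)).2
        · rw [(row z' k' (by omega)).1, (row z' k' (by omega)).2]
          exact hD z' k' hz' hk' (by omega)
      · rw [nat_of_avoids hc.avoids.1, h9']
  intro z hz k hk
  exact main.2.2 z k hz hk (Or.inl hz)

/-! ### Specifications of the routines -/

theorem exec_ascend (c d : Cmd) (m : Mem) :
    (ascend c d).exec m =
      if m.nat 12 0 0 0 % 2 = 0 then
        c.exec ((m.setNat 13 0 0 0 (m.nat 12 0 0 0)).setNat 12 0 0 0 (m.nat 12 0 0 0 / 2))
      else d.exec ((m.setNat 13 0 0 0 (m.nat 12 0 0 0)).setNat 12 0 0 0 (m.nat 12 0 0 0 / 2)) := by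
  have e : (put 12 (.half (cell 12))).exec ((put 13 (cell 12)).exec m) =
      (m.setNat 13 0 0 0 (m.nat 12 0 0 0)).setNat 12 0 0 0 (m.nat 12 0 0 0 / 2) := by
    simp [put, exec, NExp.eval]
  -- The machine has no remainder operation: a node is even exactly when it is at most twice its
  -- half.
  have h : Test.holds ((m.setNat 13 0 0 0 (m.nat 12 0 0 0)).setNat 12 0 0 0
      (m.nat 12 0 0 0 / 2)) (.natLe (cell 13) left) ↔ m.nat 12 0 0 0 % 2 = 0 := by
    simp [Test.holds, left, NExp.eval]
    omega
  rw [ascend, exec_seq, exec_seq, e]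
  split_ifs with hpar
  · exact exec_ite_pos (h.2 hpar)
  · exact exec_ite_neg (mt h.1 hpar)

theorem exec_query (m : Mem) :
    (query.exec m).real 5 0 0 0 =
      LazyTree.query (m.real 3 (m.nat 9 0 0 0) (m.nat 10 0 0 0))
        (m.real 4 (m.nat 9 0 0 0) (m.nat 10 0 0 0))
        (m.nat 6 0 0 0 + m.nat 8 (m.nat 9 0 0 0) (m.nat 4 0 0 0) 0) (m.nat 7 0 0 0) := by
  set q := m.nat 6 0 0 0 + m.nat 8 (m.nat 9 0 0 0) (m.nat 4 0 0 0) 0 with hq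
  simp only [query, exec_seq]
  have := exec_loop_induction (v := 11) (n := cell 7)
    (c := ascend (rput 5 (.plus (rcell 5) (.times (tree 4 (cell 12)) (tree 3 right))))
          (rput 5 (.times (tree 4 (cell 12)) (rcell 5))))
    ((rput 5 (tree 3 (cell 12))).exec ((put 12 (leafOf (cell 4))).exec m))
    (fun n m' => (m'.nat 9 = m.nat 9 ∧ m'.nat 10 = m.nat 10 ∧ m'.real 3 = m.real 3 ∧
      m'.real 4 = m.real 4) ∧ m'.nat 12 0 0 0 = q / 2 ^ n ∧
      m'.real 5 0 0 0 = LazyTree.query (m.real 3 (m.nat 9 0 0 0) (m.nat 10 0 0 0))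
        (m.real 4 (m.nat 9 0 0 0) (m.nat 10 0 0 0)) q n) ?_ ?_
  · have e : (cell 7).eval ((rput 5 (tree 3 (cell 12))).exec ((put 12 (leafOf (cell 4))).exec m)) =
        m.nat 7 0 0 0 := by
      simp [exec, rput, put, cell_eval]
    rw [e] at this
    exact this.2.2
  · simp [exec, rput, put, tree, leafOf, NExp.eval, RExp.eval, LazyTree.query, hq]
  · rintro n - m' ⟨⟨h9, h10, h3, h4⟩, h12, h5⟩
    rw [exec_ascend]
    simp only [Mem.setNat_nat_of_ne _ _ _ _ _ (show 12 ≠ 11 by norm_num), h12, LazyTree.query,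
      LazyTree.queryStep, LazyTree.div_pow_succ, ← h5]
    split_ifs with hpar
    · simp [exec, rput, tree, right, left, NExp.eval, RExp.eval, h9, h10, h3, h4]
      -- For an even node `h` the right child of `h / 2` is `h + 1`, the sibling that `queryStep`
      -- uses.
      left
      congr 1
      omega
    · simp [exec, rput, tree, NExp.eval, RExp.eval, h9, h10, h3, h4]

theorem exec_refresh (m : Mem) :
    refresh.exec m = m.setReal 3 (m.nat 9 0 0 0) (m.nat 10 0 0 0) (m.nat 12 0 0 0)
      (m.real 3 (m.nat 9 0 0 0) (m.nat 10 0 0 0) (2 * m.nat 12 0 0 0) +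
        m.real 4 (m.nat 9 0 0 0) (m.nat 10 0 0 0) (m.nat 12 0 0 0) *
          m.real 3 (m.nat 9 0 0 0) (m.nat 10 0 0 0) (2 * m.nat 12 0 0 0 + 1)) := by
  simp [refresh, tput, tree, right, left, exec, NExp.eval, RExp.eval, two_mul]

theorem exec_rescale (m : Mem) (z k : ℕ) (hz : m.nat 9 0 0 0 = z) (hk : m.nat 10 0 0 0 = k) :
    (rescale.exec m).real 3 z k =
        LazyTree.scaleTotals (m.real 3 z k) (m.real 4 z k) (m.real 8 k 0 0)
          (m.nat 6 0 0 0 + m.nat 8 z (m.nat 4 0 0 0) 0) (m.nat 7 0 0 0) ∧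
      (rescale.exec m).real 4 z k =
        LazyTree.scaleFactors (m.real 4 z k) (m.real 8 k 0 0)
          (m.nat 6 0 0 0 + m.nat 8 z (m.nat 4 0 0 0) 0) (m.nat 7 0 0 0) := by
  set q := m.nat 6 0 0 0 + m.nat 8 z (m.nat 4 0 0 0) 0 with hq
  simp only [rescale, exec_seq]
  have := exec_loop_induction (v := 11) (n := cell 7)
    (c := .seq (ascend (tput 4 (cell 12) (.times (tree 4 (cell 12)) (entry 8 (cell 10)))) .skip)
          refresh)
    ((tput 3 (cell 12) (.times (tree 3 (cell 12)) (entry 8 (cell 10)))).exec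
      ((put 12 (leafOf (cell 4))).exec m))
    (fun n m' => (m'.nat 9 = m.nat 9 ∧ m'.nat 10 = m.nat 10 ∧ m'.real 8 = m.real 8) ∧
      m'.nat 12 0 0 0 = q / 2 ^ n ∧
      m'.real 3 z k = LazyTree.scaleTotals (m.real 3 z k) (m.real 4 z k) (m.real 8 k 0 0) q n ∧
      m'.real 4 z k = LazyTree.scaleFactors (m.real 4 z k) (m.real 8 k 0 0) q n) ?_ ?_
  · have e : (cell 7).eval ((tput 3 (cell 12) (.times (tree 3 (cell 12)) (entry 8 (cell 10)))).exec
        ((put 12 (leafOf (cell 4))).exec m)) = m.nat 7 0 0 0 := by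
      simp [exec, tput, put, cell_eval]
    rw [e] at this
    exact this.2.2
  · simp [exec, tput, put, tree, leafOf, entry, NExp.eval, RExp.eval, LazyTree.scaleTotals,
      LazyTree.scaleFactors, hq, hz, hk]
  · rintro n - m' ⟨⟨h9, h10, h8⟩, h12, h3, h4⟩
    rw [exec, exec_refresh, exec_ascend]
    simp only [Mem.setNat_nat_of_ne _ _ _ _ _ (show 12 ≠ 11 by norm_num), h12,
      LazyTree.scaleTotals, LazyTree.scaleFactors, LazyTree.div_pow_succ]
    split_ifs with hpar
    · simp [exec, tput, tree, entry, NExp.eval, RExp.eval, h9, h10, h8, h3, h4, hz, hk]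
    · simp [exec, h9, h10, h8, h3, h4, hz, hk]

/-- Memory between two trials: `N` contexts, `K` actions, ranks `p`, depth `d`, learning rate `η`,
and leaf weights `a z k` of the tree for centre `z` and action `k`. -/
structure Ready (N K d : ℕ) (p : ℕ → ℕ → ℕ) (η : ℝ) (a : ℕ → ℕ → ℕ → ℝ) (m : Mem) : Prop where
  contexts : m.nat 0 0 0 0 = N
  actions : m.nat 1 0 0 0 = K
  leaves : m.nat 6 0 0 0 = 2 ^ d
  depth : m.nat 7 0 0 0 = d
  rank : ∀ z < N, ∀ x < N, m.nat 8 z x 0 = p z x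
  rate : m.real 7 0 0 0 = η
  trees : ∀ z < N, ∀ k < K, LazyTree.Represents (m.real 3 z k) (m.real 4 z k) d (a z k)

theorem Ready.congr {N K d : ℕ} {p : ℕ → ℕ → ℕ} {η : ℝ} {a : ℕ → ℕ → ℕ → ℝ} {m m' : Mem}
    (h : Ready N K d p η a m)
    (hn : ∀ i, i = 0 ∨ i = 1 ∨ i = 6 ∨ i = 7 ∨ i = 8 → m'.nat i = m.nat i)
    (hr : ∀ i, i = 3 ∨ i = 4 ∨ i = 7 → m'.real i = m.real i) : Ready N K d p η a m' := by
  obtain ⟨h0, h1, h6, h7, h8, hη, ht⟩ := h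
  constructor
  · rwa [hn 0 (by simp)]
  · rwa [hn 1 (by simp)]
  · rwa [hn 6 (by simp)]
  · rwa [hn 7 (by simp)]
  · rwa [hn 8 (by simp)]
  · rwa [hr 7 (by simp)]
  · rwa [hr 3 (by simp), hr 4 (by simp)]

section

variable {N K d : ℕ} {p : ℕ → ℕ → ℕ} {η : ℝ} {a : ℕ → ℕ → ℕ → ℝ} {m : Mem} {x : ℕ}

/-- Total leaf weight of the action `k` on the balls that contain `x`. -/
def total (N d : ℕ) (p : ℕ → ℕ → ℕ) (a : ℕ → ℕ → ℕ → ℝ) (x k : ℕ) : ℝ :=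
  ∑ z ∈ Finset.range N, ∑ q ∈ Finset.Ico (2 ^ d) (2 ^ (d + 1)),
    if 2 ^ d + p z x ≤ q then a z k q else 0

theorem Ready.exec_query (h : Ready N K d p η a m) (hp : ∀ z < N, ∀ x < N, p z x < 2 ^ d)
    (hx : x < N) (hctx : m.nat 4 0 0 0 = x) {z k : ℕ} (hz : z < N) (hk : k < K)
    (h9 : m.nat 9 0 0 0 = z) (h10 : m.nat 10 0 0 0 = k) :
    (query.exec m).real 5 0 0 0 = ∑ q ∈ Finset.Ico (2 ^ d) (2 ^ (d + 1)),
      if 2 ^ d + p z x ≤ q then a z k q else 0 := by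
  rw [Prog.exec_query, h9, h10, hctx, h.leaves, h.depth, h.rank z hz x hx]
  have := hp z hz x hx
  exact (h.trees z hz k hk).query_eq (by omega) (by rw [pow_succ]; omega)

theorem Ready.exec_sumQueries (h : Ready N K d p η a m) (hp : ∀ z < N, ∀ x < N, p z x < 2 ^ d)
    (hx : x < N) (hctx : m.nat 4 0 0 0 = x) {k : ℕ} (hk : k < K) (h10 : m.nat 10 0 0 0 = k) :
    (∀ i, (sumQueries.exec m).real 1 i 0 0 =
      if i = k then total N d p a x k else m.real 1 i 0 0) ∧
    (sumQueries.exec m).real 6 0 0 0 = m.real 6 0 0 0 + total N d p a x k := by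
  set m₁ := (eput 1 (cell 10) (.ofNat (.const 0))).exec m with hm₁
  have hr1 : m₁.real 1 = (m.setReal 1 k 0 0 0).real 1 := by
    simp [hm₁, eput, exec, NExp.eval, RExp.eval, h10]
  have := exec_loop_induction (v := 9) (n := cell 0)
    (c := .seq query (eput 1 (cell 10) (.plus (entry 1 (cell 10)) (rcell 5)))) m₁
    (fun n m' => (∀ a, a = 0 ∨ a = 1 ∨ a = 4 ∨ a = 6 ∨ a = 7 ∨ a = 8 ∨ a = 10 →
        m'.nat a = m.nat a) ∧ (∀ a, a = 3 ∨ a = 4 ∨ a = 6 ∨ a = 7 → m'.real a = m.real a) ∧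
      ∀ i, m'.real 1 i 0 0 = if i = k then ∑ z ∈ Finset.range n,
        ∑ q ∈ Finset.Ico (2 ^ d) (2 ^ (d + 1)), if 2 ^ d + p z x ≤ q then a z k q else 0
          else m.real 1 i 0 0) ?_ ?_
  · have e0 : (cell 0).eval m₁ = N := h.contexts
    rw [e0] at this
    obtain ⟨hn, hr, hs⟩ := this
    rw [sumQueries, exec_seq, exec_seq, ← hm₁]
    generalize (loop 9 (cell 0) (.seq query (eput 1 (cell 10)
      (.plus (entry 1 (cell 10)) (rcell 5))))).exec m₁ = m₂ at *
    constructor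
    · simpa [rput, exec, total] using hs
    · simp [rput, exec, entry, RExp.eval, NExp.eval, hr, hn, h10, hs, total]
  · refine ⟨fun a _ => rfl, fun a ha => ?_, fun i => ?_⟩
    · exact Mem.setReal_real_of_ne _ _ _ _ _ (by omega)
    · rw [hr1, Mem.setReal_column]; simp
  · rintro n hn m' ⟨hN, hR, hS⟩
    have e0 : (cell 0).eval m₁ = N := h.contexts
    rw [e0] at hn
    set m₂ := m'.setNat 9 0 0 0 n with hm₂
    have hN₂ : ∀ a, a = 0 ∨ a = 1 ∨ a = 4 ∨ a = 6 ∨ a = 7 ∨ a = 8 ∨ a = 10 →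
        m₂.nat a = m.nat a := fun a ha => by
      rw [hm₂, Mem.setNat_nat_of_ne _ _ _ _ _ (by omega), hN a ha]
    have hready : Ready N K d p η a m₂ := h.congr (fun i hi => hN₂ i (by omega))
      (fun i hi => hR i (by omega))
    have hq := hready.exec_query hp hx (by rw [hN₂ 4 (by simp), hctx]) (z := n) hn hk
      (by simp [hm₂]) (by rw [hN₂ 10 (by simp), h10])
    have hqn : ∀ a, query.AvoidsNat a → (query.exec m₂).nat a = m₂.nat a :=
      fun a ha => nat_of_avoids ha m₂
    have hqr : ∀ a, query.AvoidsReal a → (query.exec m₂).real a = m₂.real a :=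
      fun a ha => real_of_avoids ha m₂
    have hq10 : (query.exec m₂).nat 10 = m.nat 10 := by
      rw [hqn 10 (by simp [query, AvoidsNat, put, rput, ascend]), hN₂ 10 (by simp)]
    have hq1 : (query.exec m₂).real 1 = m'.real 1 := by
      rw [hqr 1 (by simp [query, AvoidsReal, put, rput, ascend]), hm₂, Mem.setNat_real]
    refine ⟨fun a ha => ?_, fun a ha => ?_, fun i => ?_⟩
    · rw [exec_seq, nat_of_avoids (by trivial), hqn a, hN₂ a ha]
      simp only [query, AvoidsNat, put, rput, ascend, and_true, true_and]
      omega
    · rw [exec_seq, real_of_avoids (by simp only [eput, AvoidsReal]; omega), hqr a, hm₂,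
        Mem.setNat_real, hR a ha]
      simp only [query, AvoidsReal, put, rput, ascend, true_and]
      omega
    · simp only [eput, exec, entry, RExp.eval, NExp.eval, cell_eval, rcell_eval, hq10,
        h10, hq, hq1]
      rw [Mem.setReal_column, hq1, hS, hS, Finset.sum_range_succ]
      split_ifs <;> simp_all

/-- Specification of `choose`: the array `1` holds the stochastic action and the scalar `6` the
factor by which the projection divides. -/
theorem Ready.exec_choose (h : Ready N K d p η a m) (hp : ∀ z < N, ∀ x < N, p z x < 2 ^ d)
    (hx : x < N) (hctx : m.nat 4 0 0 0 = x) :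
    Ready N K d p η a (choose.exec m) ∧ (choose.exec m).nat 4 0 0 0 = x ∧
    (choose.exec m).real 6 0 0 0 = max 1 (∑ k ∈ Finset.range K, total N d p a x k) ∧
    ∀ k < K, (choose.exec m).real 1 k 0 0 =
      total N d p a x k / max 1 (∑ k ∈ Finset.range K, total N d p a x k) := by
  refine ⟨h.congr (fun i hi => nat_of_avoids ?_ m) (fun i hi => real_of_avoids ?_ m), ?_, ?_⟩
  · simp only [choose, sumQueries, query, AvoidsNat, put, rput, eput, ascend, and_true, true_and]
    omega
  · simp only [choose, sumQueries, query, AvoidsReal, put, rput, eput, ascend, and_true, true_and]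
    omega
  · rw [nat_of_avoids (by simp [choose, sumQueries, query, AvoidsNat, put, rput, eput, ascend]),
      hctx]
  set m₁ := (rput 6 (.ofNat (.const 0))).exec m with hm₁
  have first := exec_loop_induction (v := 10) (n := cell 1) (c := sumQueries) m₁
    (fun n m' => (∀ a, a = 0 ∨ a = 1 ∨ a = 4 ∨ a = 6 ∨ a = 7 ∨ a = 8 →
        m'.nat a = m.nat a) ∧ (∀ a, a = 3 ∨ a = 4 ∨ a = 7 → m'.real a = m.real a) ∧
      m'.real 6 0 0 0 = ∑ k ∈ Finset.range n, total N d p a x k ∧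
      ∀ k < n, m'.real 1 k 0 0 = total N d p a x k) ?_ ?_
  rotate_left
  · refine ⟨fun a _ => rfl, fun a ha => Mem.setReal_real_of_ne _ _ _ _ _ (by omega), ?_, ?_⟩
    · simp [hm₁, rput, exec, RExp.eval, NExp.eval]
    · simp
  · rintro n hn m' ⟨hN, hR, hZ, hS⟩
    have e1 : (cell 1).eval m₁ = K := h.actions
    rw [e1] at hn
    have hN₂ : ∀ a, a = 0 ∨ a = 1 ∨ a = 4 ∨ a = 6 ∨ a = 7 ∨ a = 8 →
        (m'.setNat 10 0 0 0 n).nat a = m.nat a := fun a ha => by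
      rw [Mem.setNat_nat_of_ne _ _ _ _ _ (by omega), hN a ha]
    have hready : Ready N K d p η a (m'.setNat 10 0 0 0 n) :=
      h.congr (fun i hi => hN₂ i (by omega)) (fun i hi => hR i (by omega))
    have hq := hready.exec_sumQueries hp hx (by rw [hN₂ 4 (by simp), hctx]) (k := n) hn (by simp)
    refine ⟨fun a ha => ?_, fun a ha => ?_, ?_, fun k hk => ?_⟩
    · rw [nat_of_avoids, hN₂ a ha]
      simp only [sumQueries, query, AvoidsNat, put, rput, eput, ascend, and_true, true_and]
      omega
    · rw [real_of_avoids, Mem.setNat_real, hR a ha]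
      simp only [sumQueries, query, AvoidsReal, put, rput, eput, ascend, true_and]
      omega
    · rw [hq.2, Mem.setNat_real, hZ, Finset.sum_range_succ]
    · rw [hq.1, Mem.setNat_real]
      split_ifs with hkn
      · rw [hkn]
      · exact hS k (by omega)
  have e1 : (cell 1).eval m₁ = K := h.actions
  rw [e1] at first
  set m₂ := (loop 10 (cell 1) sumQueries).exec m₁ with hm₂
  obtain ⟨hN, hR, hZ, hS⟩ := first
  set Z := ∑ k ∈ Finset.range K, total N d p a x k with hZdef
  set m₃ := (Cmd.ite (.realLe (rcell 6) (.ofNat (.const 1))) (rput 6 (.ofNat (.const 1))) .skip).exec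
    m₂ with hm₃
  -- The conditional computes `max 1 Z`, the closed form of the projection, so no multiplier has to
  -- be found.
  have h3 : m₃.real 6 0 0 0 = max 1 Z ∧ m₃.real 1 = m₂.real 1 ∧ m₃.nat = m₂.nat := by
    by_cases hle : Z ≤ 1
    · rw [hm₃, exec_ite_pos (by simpa [Test.holds, RExp.eval, NExp.eval, hZ] using hle),
        max_eq_left hle]
      simp [rput, exec, RExp.eval, NExp.eval]
    · rw [hm₃, exec_ite_neg (by simpa [Test.holds, RExp.eval, NExp.eval, hZ] using hle),
        max_eq_right (not_le.1 hle).le]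
      exact ⟨hZ, rfl, rfl⟩
  have hexec : choose.exec m =
      (loop 10 (cell 1) (eput 1 (cell 10) (.divide (entry 1 (cell 10)) (rcell 6)))).exec m₃ := rfl
  have last := exec_loop_induction (v := 10) (n := cell 1)
    (c := eput 1 (cell 10) (.divide (entry 1 (cell 10)) (rcell 6))) m₃
    (fun n m' => m'.real 6 0 0 0 = max 1 Z ∧ ∀ k < K, m'.real 1 k 0 0 =
      if k < n then total N d p a x k / max 1 Z else total N d p a x k) ?_ ?_
  · have e1 : (cell 1).eval m₃ = K := by
      rw [cell_eval, h3.2.2, hN 1 (by simp), h.actions]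
    rw [e1] at last
    rw [hexec]
    refine ⟨last.1, fun k hk => ?_⟩
    rw [last.2 k hk, if_pos hk]
  · refine ⟨h3.1, fun k hk => ?_⟩
    rw [h3.2.1, hS k hk]
    simp
  · rintro n hn m' ⟨hZ', hS'⟩
    refine ⟨by simp [eput, exec, hZ'], fun k hk => ?_⟩
    simp only [eput, exec, entry, RExp.eval, NExp.eval, cell_eval, rcell_eval, Mem.setNat_nat_self,
      Mem.setNat_real, Mem.setReal_column, hZ']
    by_cases hkn : k = n
    · subst hkn
      simp [hS' k hk]
    · rw [if_neg hkn, hS' k hk]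
      refine if_congr ?_ rfl rfl
      omega

/-- The factor combines the division by the projection scale with the exponential update, so each
tree is touched only once. Actions not drawn have estimate 1. After abstention `b` is `K`, and the
extra write falls outside the cells `k < K`. -/
theorem exec_factors (b k : ℕ) (hb : m.nat 5 0 0 0 = b) (hk : k < m.nat 1 0 0 0) :
    (factors.exec m).real 8 k 0 0 = Real.exp (m.real 7 0 0 0 *
      (1 - if k = b then (1 - m.real 2 0 0 0) / m.real 1 k 0 0 else 0)) / m.real 6 0 0 0 := by
  have := exec_loop_induction (v := 10) (n := cell 1)
    (c := eput 8 (cell 10) (.divide (.exp (rcell 7)) (rcell 6))) m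
    (fun n m' => m'.nat 5 = m.nat 5 ∧ (∀ a, a ≠ 8 → m'.real a = m.real a) ∧
      ∀ k < n, m'.real 8 k 0 0 = Real.exp (m.real 7 0 0 0) / m.real 6 0 0 0) ?_ ?_
  · obtain ⟨h5, hR, hS⟩ := this
    rw [factors, exec_seq]
    generalize (loop 10 (cell 1) (eput 8 (cell 10) (.divide (.exp (rcell 7)) (rcell 6)))).exec m =
      m₁ at *
    simp only [eput, exec, entry, RExp.eval, NExp.eval, cell_eval, rcell_eval, Mem.setReal_column]
    rw [h5, hb, hR 7 (by norm_num), hR 2 (by norm_num), hR 6 (by norm_num), hR 1 (by norm_num)]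
    split_ifs with hkb
    · simp [hkb]
    · rw [hS k hk]
      simp
  · exact ⟨rfl, fun _ _ => rfl, by simp⟩
  · rintro n - m' ⟨h5, hR, hS⟩
    refine ⟨by simp [eput, exec, h5], fun a ha => ?_, fun k hk => ?_⟩
    · simp only [eput, exec]
      rw [Mem.setReal_real_of_ne _ _ _ _ _ ha, Mem.setNat_real, hR a ha]
    · simp only [eput, exec, RExp.eval, NExp.eval, cell_eval, rcell_eval, Mem.setNat_nat_self,
        Mem.setNat_real, Mem.setReal_column]
      rw [hR 7 (by norm_num), hR 6 (by norm_num)]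
      split_ifs with hkn
      · rfl
      · exact hS k (by omega)

/-- Specification of `learn`: the leaves from the current context on are multiplied. -/
theorem Ready.exec_learn (h : Ready N K d p η a m) (hp : ∀ z < N, ∀ x < N, p z x < 2 ^ d)
    (hx : x < N) (hctx : m.nat 4 0 0 0 = x) {b : ℕ} (hb : m.nat 5 0 0 0 = b) :
    Ready N K d p η (fun z k q => a z k q * if 2 ^ d + p z x ≤ q then
      Real.exp (η * (1 - if k = b then (1 - m.real 2 0 0 0) / m.real 1 k 0 0 else 0)) /
        m.real 6 0 0 0 else 1) (learn.exec m) := by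
  have hmid : Ready N K d p η a (factors.exec m) :=
    h.congr (fun i hi => nat_of_avoids (by simp only [factors, AvoidsNat, eput, and_true]; omega) m)
      (fun i hi => real_of_avoids (by simp only [factors, AvoidsReal, eput]; omega) m)
  have hmid4 : (factors.exec m).nat 4 0 0 0 = x := by
    rw [nat_of_avoids (by simp [factors, AvoidsNat, eput]), hctx]
  have hnat : ∀ i, i = 0 ∨ i = 1 ∨ i = 6 ∨ i = 7 ∨ i = 8 →
      ((forTrees rescale).exec (factors.exec m)).nat i = (factors.exec m).nat i := fun i hi =>
    nat_of_avoids (by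
      simp only [forTrees, rescale, AvoidsNat, put, tput, ascend, refresh, and_true, true_and]; omega) _
  have trees := exec_forTrees (c := rescale)
    (by simp [rescale, TreeLocal, put, tput, ascend, refresh])
    (by simp [rescale, AvoidsNat, put, tput, ascend, refresh]) (factors.exec m)
    (fun z k V R => LazyTree.Represents V R d (fun q => a z k q * if 2 ^ d + p z x ≤ q then
      Real.exp (η * (1 - if k = b then (1 - m.real 2 0 0 0) / m.real 1 k 0 0 else 0)) /
        m.real 6 0 0 0 else 1)) ?_
  · rw [hmid.contexts, hmid.actions] at trees
    rw [learn, exec_seq]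
    refine ⟨?_, ?_, ?_, ?_, ?_, ?_, trees⟩
    · rw [hnat 0 (by simp), hmid.contexts]
    · rw [hnat 1 (by simp), hmid.actions]
    · rw [hnat 6 (by simp), hmid.leaves]
    · rw [hnat 7 (by simp), hmid.depth]
    · rw [hnat 8 (by simp)]; exact hmid.rank
    · rw [real_of_avoids (by
        simp [forTrees, rescale, AvoidsReal, put, tput, ascend, refresh]), hmid.rate]
  · intro z hz k hk m' hN hR h9 h10 h3 h4
    rw [hmid.contexts] at hz
    rw [hmid.actions] at hk
    have hav : ∀ i, i = 4 ∨ i = 6 ∨ i = 7 ∨ i = 8 → m'.nat i = (factors.exec m).nat i :=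
      fun i hi => hN i (by omega) (by omega) (by
        simp only [rescale, AvoidsNat, put, tput, ascend, refresh, and_true, true_and]; omega)
    have h8 : m'.real 8 = (factors.exec m).real 8 :=
      hR 8 (by simp [rescale, AvoidsReal, put, tput, ascend, refresh])
    have := exec_rescale m' z k h9 h10
    rw [this.1, this.2, h3, h4, h8, hav 4 (by simp), hav 6 (by simp), hav 7 (by simp),
      hav 8 (by simp), hmid4, hmid.leaves, hmid.depth, hmid.rank z hz x hx,
      exec_factors b k hb (by rwa [h.actions]), h.rate]
    have hpz := hp z hz x hx
    exact (hmid.trees z hz k hk).scale _ (by omega) (by rw [pow_succ]; omega)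

end

/-! ### Preparation: tree sizes, distance ranks, initial trees and learning rate. -/

theorem exec_sizes (m : Mem) (h0 : 1 ≤ m.nat 0 0 0 0) (h7 : m.nat 7 0 0 0 = 0) :
    ∃ d, (sizes.exec m).nat 6 0 0 0 = 2 ^ d ∧ (sizes.exec m).nat 7 0 0 0 = d ∧
      m.nat 0 0 0 0 ≤ 2 ^ d ∧ 2 ^ d < 2 * m.nat 0 0 0 0 := by
  have := exec_loop_induction (v := 9) (n := cell 0)
    (c := .ite (.natLe (cell 0) (cell 6)) .skip
      (.seq (put 6 (.plus (cell 6) (cell 6))) (put 7 (.plus (cell 7) (.const 1)))))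
    ((put 6 (.const 1)).exec m)
    -- Either `2 ^ d` has reached `N` or every turn so far has doubled it; `N` turns suffice because
    -- `N < 2 ^ N`. Doubling happens only while `2 ^ d < N`, which keeps `2 ^ d < 2 * N`.
    (fun n m' => m'.nat 0 0 0 0 = m.nat 0 0 0 0 ∧ ∃ d, m'.nat 6 0 0 0 = 2 ^ d ∧
      m'.nat 7 0 0 0 = d ∧ 2 ^ d < 2 * m.nat 0 0 0 0 ∧ (m.nat 0 0 0 0 ≤ 2 ^ d ∨ n ≤ d)) ?_ ?_
  · obtain ⟨-, d, h6, h7, hlt, hle⟩ := this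
    have e : (cell 0).eval ((put 6 (.const 1)).exec m) = m.nat 0 0 0 0 := by simp [put, exec]
    rw [e] at hle
    exact ⟨d, h6, h7, hle.elim id fun h => h.trans Nat.lt_two_pow_self.le, hlt⟩
  · exact ⟨by simp [put, exec], 0, by simp [put, exec, NExp.eval], by simp [put, exec, h7],
      by omega, Or.inr le_rfl⟩
  · rintro n - m' ⟨hN, d, h6, hd, hlt, hle⟩
    by_cases hcmp : m.nat 0 0 0 0 ≤ 2 ^ d
    · rw [exec_ite_pos (by simpa [Test.holds, hN, h6] using hcmp)]
      exact ⟨by simp [exec, hN], d, by simp [exec, h6], by simp [exec, hd], hlt, Or.inl hcmp⟩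
    · rw [exec_ite_neg (by simpa [Test.holds, hN, h6] using hcmp)]
      refine ⟨by simp [exec, put, hN], d + 1, ?_, by simp [exec, put, NExp.eval, hd], ?_,
        Or.inr (by omega)⟩
      · simp [exec, put, NExp.eval, h6, pow_succ, mul_two]
      · rw [pow_succ]; omega

/-- Number of points that are closer to `z` than `x`, for the distance matrix `D`. -/
def rankOf (D : ℕ → ℕ → ℝ) (N z x : ℕ) : ℕ := by
  classical exact ((Finset.range N).filter fun y => D z y < D z x).card

theorem rankOf_succ (D : ℕ → ℕ → ℝ) (N z x : ℕ) [Decidable (D z N < D z x)] :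
    rankOf D (N + 1) z x = rankOf D N z x + if D z N < D z x then 1 else 0 := by
  classical
  simp only [rankOf, Finset.card_filter, Finset.sum_range_succ]
  congr

theorem rankOf_lt (D : ℕ → ℕ → ℝ) {N z x : ℕ} (hx : x < N) : rankOf D N z x < N := by
  classical
  have : (Finset.range N).filter (fun y => D z y < D z x) ⊂ Finset.range N :=
    Finset.filter_ssubset.2 ⟨x, Finset.mem_range.2 hx, lt_irrefl _⟩
  simpa [rankOf] using Finset.card_lt_card this

/-- Strictness of the count makes equidistant points share a rank. If `y` is closer than `x`, then
`y` itself is counted for `x` but not for `y`. -/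
theorem rankOf_le_iff (D : ℕ → ℕ → ℝ) {N z x y : ℕ} (hy : y < N) :
    rankOf D N z x ≤ rankOf D N z y ↔ D z x ≤ D z y := by
  classical
  constructor
  · intro h
    by_contra hlt
    rw [not_le] at hlt
    refine absurd h (not_le.2 (Finset.card_lt_card ?_))
    rw [Finset.ssubset_iff_of_subset]
    · exact ⟨y, by simp [hy, hlt], by simp⟩
    · exact Finset.monotone_filter_right _ fun v _ hv => hv.trans hlt
  · intro h
    exact Finset.card_le_card (Finset.monotone_filter_right _ fun v _ hv => hv.trans_le h)

theorem exec_ranks (m : Mem) {N : ℕ} (h0 : m.nat 0 0 0 0 = N) (h8 : ∀ z x, m.nat 8 z x 0 = 0) :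
    ∀ z < N, ∀ x < N,
      (ranks.exec m).nat 8 z x 0 = rankOf (fun i j => m.real 0 i j 0) N z x := by
  classical
  set D : ℕ → ℕ → ℝ := fun i j => m.real 0 i j 0 with hD
  let Good : Mem → Prop := fun m' => m'.nat 0 0 0 0 = N ∧ m'.real 0 = m.real 0
  let body : Cmd := .ite (.realLe (.read 0 (cell 9) (cell 10) (.const 0))
    (.read 0 (cell 9) (cell 11) (.const 0))) .skip
      (.setNat 8 (cell 9) (cell 10) (.const 0)
        (.plus (.read 8 (cell 9) (cell 10) (.const 0)) (.const 1)))
  have inner : ∀ (z x : ℕ) (m₁ : Mem), Good m₁ → m₁.nat 9 0 0 0 = z → m₁.nat 10 0 0 0 = x →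
      ∀ z' x', ((loop 11 (cell 0) body).exec m₁).nat 8 z' x' 0 =
        m₁.nat 8 z' x' 0 + if z' = z ∧ x' = x then rankOf D N z x else 0 := by
    intro z x m₁ hg h9 h10
    have := exec_loop_induction (v := 11) (n := cell 0) (c := body) m₁
      (fun n m' => m'.nat 9 = m₁.nat 9 ∧ m'.nat 10 = m₁.nat 10 ∧ m'.real 0 = m.real 0 ∧
        ∀ z' x', m'.nat 8 z' x' 0 =
          m₁.nat 8 z' x' 0 + if z' = z ∧ x' = x then rankOf D n z x else 0)
      ⟨rfl, rfl, hg.2, fun z' x' => by simp [rankOf]⟩ ?_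
    · rw [cell_eval, hg.1] at this
      exact this.2.2.2
    · rintro n - m' ⟨h9', h10', hr, hS⟩
      by_cases hcmp : D z x ≤ D z n
      · rw [exec_ite_pos (by
          simpa [Test.holds, RExp.eval, NExp.eval, h9', h10', hr, h9, h10] using hcmp)]
        refine ⟨by simp [exec, h9'], by simp [exec, h10'], hr, fun z' x' => ?_⟩
        rw [rankOf_succ, if_neg (not_lt.2 hcmp)]
        simp [exec, hS]
      · rw [exec_ite_neg (by
          simpa [Test.holds, RExp.eval, NExp.eval, h9', h10', hr, h9, h10] using hcmp)]
        refine ⟨by simp [exec, h9'], by simp [exec, h10'], hr, fun z' x' => ?_⟩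
        rw [rankOf_succ, if_pos (not_le.1 hcmp)]
        simp only [exec, NExp.eval, cell_eval]
        rw [Mem.setNat_entry]
        simp [hS, h9', h10', h9, h10]
        split_ifs with h
        · rw [h.1, h.2]; ring
        · rfl
  have middle : ∀ (z : ℕ) (m₁ : Mem), Good m₁ → m₁.nat 9 0 0 0 = z →
      ∀ z' x', ((loop 10 (cell 0) (loop 11 (cell 0) body)).exec m₁).nat 8 z' x' 0 =
        m₁.nat 8 z' x' 0 + if z' = z ∧ x' < N then rankOf D N z' x' else 0 := by
    intro z m₁ hg h9
    have := exec_loop_induction (v := 10) (n := cell 0) (c := loop 11 (cell 0) body) m₁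
      (fun n m' => m'.nat 9 = m₁.nat 9 ∧ Good m' ∧
        ∀ z' x', m'.nat 8 z' x' 0 =
          m₁.nat 8 z' x' 0 + if z' = z ∧ x' < n then rankOf D N z' x' else 0)
      ⟨rfl, hg, fun z' x' => by simp⟩ ?_
    · rw [cell_eval, hg.1] at this
      exact this.2.2
    · rintro n - m' ⟨h9', hg', hS⟩
      refine ⟨?_, ⟨?_, ?_⟩, fun z' x' => ?_⟩
      · rw [nat_of_avoids (by simp [body, AvoidsNat])]; simpa using h9'
      · rw [nat_of_avoids (by simp [body, AvoidsNat])]; simpa using hg'.1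
      · rw [real_of_avoids (by simp [body, AvoidsReal])]; exact hg'.2
      · rw [inner z n (m'.setNat 10 0 0 0 n) ⟨by simpa using hg'.1, hg'.2⟩ (by simp [h9', h9]) (by simp)]
        rw [Mem.setNat_nat_of_ne _ _ _ _ _ (by norm_num), hS, add_assoc]
        congr 1
        by_cases h1 : z' = z ∧ x' = n
        · obtain ⟨rfl, rfl⟩ := h1
          simp
        · rw [if_neg h1, add_zero]
          refine if_congr ?_ rfl rfl
          omega
  have := exec_loop_induction (v := 9) (n := cell 0)
    (c := loop 10 (cell 0) (loop 11 (cell 0) body)) m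
    (fun n m' => Good m' ∧ ∀ z' x', m'.nat 8 z' x' 0 =
        if z' < n ∧ x' < N then rankOf D N z' x' else 0)
    ⟨⟨h0, rfl⟩, fun z' x' => by simp [h8]⟩ ?_
  · intro z hz x hx
    rw [cell_eval, h0] at this
    exact (this.2 z x).trans (if_pos ⟨hz, hx⟩)
  · rintro n - m' ⟨hg', hS⟩
    refine ⟨⟨?_, ?_⟩, fun z' x' => ?_⟩
    · rw [nat_of_avoids (by simp [body, AvoidsNat])]; simpa using hg'.1
    · rw [real_of_avoids (by simp [body, AvoidsReal])]; exact hg'.2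
    · rw [middle n (m'.setNat 9 0 0 0 n) ⟨by simpa using hg'.1, hg'.2⟩ (by simp)]
      rw [Mem.setNat_nat_of_ne _ _ _ _ _ (by norm_num), hS]
      by_cases h1 : z' = n ∧ x' < N
      · obtain ⟨rfl, h1⟩ := h1
        simp [h1]
      · rw [if_neg h1, add_zero]
        refine if_congr ?_ rfl rfl
        omega

/-- The routine adds to the leaves instead of assigning them, because points at equal distance from
the centre share a leaf. -/
theorem exec_fillLeaves (m : Mem) {z k N d : ℕ} {p : ℕ → ℕ} (h0 : m.nat 0 0 0 0 = N)
    (h6 : m.nat 6 0 0 0 = 2 ^ d) (h8 : ∀ y < N, m.nat 8 z y 0 = p y) (h9 : m.nat 9 0 0 0 = z)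
    (h10 : m.nat 10 0 0 0 = k) (h3 : ∀ q, m.real 3 z k q = 0) (q : ℕ) :
    (fillLeaves.exec m).real 3 z k q =
      ∑ y ∈ Finset.range N, if 2 ^ d + p y = q then m.real 5 0 0 0 else 0 := by
  have := exec_loop_induction (v := 11) (n := cell 0)
    (c := tput 3 (leafOf (cell 11)) (.plus (tree 3 (leafOf (cell 11))) (rcell 5))) m
    (fun n m' => (∀ i, i ≠ 11 → m'.nat i = m.nat i) ∧ m'.real 5 = m.real 5 ∧
      ∀ q, m'.real 3 z k q =
        ∑ y ∈ Finset.range n, if 2 ^ d + p y = q then m.real 5 0 0 0 else 0)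
    ⟨fun _ _ => rfl, rfl, by simp [h3]⟩ ?_
  · rw [cell_eval, h0] at this
    exact this.2.2 q
  · rintro n hn m' ⟨hN, hR, hS⟩
    rw [cell_eval, h0] at hn
    have hr : (tput 3 (leafOf (cell 11)) (.plus (tree 3 (leafOf (cell 11))) (rcell 5))).exec
        (m'.setNat 11 0 0 0 n) = (m'.setNat 11 0 0 0 n).setReal 3 z k (2 ^ d + p n)
          (m'.real 3 z k (2 ^ d + p n) + m.real 5 0 0 0) := by
      simp [tput, exec, leafOf, tree, NExp.eval, RExp.eval, hN, hR, h9, h10, h6, h8 n hn]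
    rw [hr]
    refine ⟨fun i hi => by simp [hi, hN], by simp [hR], fun q => ?_⟩
    rw [Mem.setReal_row, Mem.setNat_real, Finset.sum_range_succ]
    by_cases hq : 2 ^ d + p n = q
    · subst hq
      simp [hS]
    · rw [Function.update_of_ne (Ne.symm hq), hS, if_neg hq, add_zero]

theorem exec_fillFactors (m : Mem) {z k : ℕ} (h9 : m.nat 9 0 0 0 = z) (h10 : m.nat 10 0 0 0 = k) :
    ∀ h < m.nat 6 0 0 0, (fillFactors.exec m).real 4 z k h = 1 := by
  refine (exec_loop_induction (v := 11) (n := cell 6)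
    (c := tput 4 (cell 11) (.ofNat (.const 1))) m
    (fun n m' => m'.nat 9 = m.nat 9 ∧ m'.nat 10 = m.nat 10 ∧ ∀ h < n, m'.real 4 z k h = 1)
    ⟨rfl, rfl, by simp⟩ ?_).2.2
  rintro n - m' ⟨h9', h10', hS⟩
  have hr : (tput 4 (cell 11) (.ofNat (.const 1))).exec (m'.setNat 11 0 0 0 n) =
      (m'.setNat 11 0 0 0 n).setReal 4 z k n 1 := by
    simp [tput, exec, NExp.eval, RExp.eval, h9', h10', h9, h10]
  rw [hr]
  refine ⟨by simp [h9'], by simp [h10'], fun h hh => ?_⟩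
  rw [Mem.setReal_row, Mem.setNat_real]
  by_cases hn : h = n
  · subst hn; simp
  · rw [Function.update_of_ne hn, hS h (by omega)]

theorem exec_fillNodes (m : Mem) {z k L : ℕ} (h6 : m.nat 6 0 0 0 = L) (h9 : m.nat 9 0 0 0 = z)
    (h10 : m.nat 10 0 0 0 = k) :
    (fillNodes.exec m).real 4 = m.real 4 ∧
    (∀ h, L ≤ h → (fillNodes.exec m).real 3 z k h = m.real 3 z k h) ∧
    ∀ h, 1 ≤ h → h < L → (fillNodes.exec m).real 3 z k h =
      (fillNodes.exec m).real 3 z k (2 * h) +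
        m.real 4 z k h * (fillNodes.exec m).real 3 z k (2 * h + 1) := by
  have := exec_loop_induction (v := 11) (n := cell 6)
    (c := .seq (put 12 (.minus (cell 6) (.plus (cell 11) (.const 1)))) refresh) m
    (fun n m' => (m'.nat 6 = m.nat 6 ∧ m'.nat 9 = m.nat 9 ∧ m'.nat 10 = m.nat 10) ∧
      m'.real 4 = m.real 4 ∧ (∀ h, L ≤ h → m'.real 3 z k h = m.real 3 z k h) ∧
      ∀ h, 1 ≤ h → L - n ≤ h → h < L → m'.real 3 z k h =
        m'.real 3 z k (2 * h) + m.real 4 z k h * m'.real 3 z k (2 * h + 1))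
    ⟨⟨rfl, rfl, rfl⟩, rfl, fun _ _ => rfl, fun h h1 h2 h3 => by omega⟩ ?_
  · rw [cell_eval, h6] at this
    obtain ⟨-, hR, hleaf, hnode⟩ := this
    exact ⟨hR, hleaf, fun h h1 h2 => hnode h h1 (by omega) h2⟩
  · rintro n hn m' ⟨⟨h6', h9', h10'⟩, hR, hleaf, hnode⟩
    rw [cell_eval, h6] at hn
    rw [exec_seq, exec_refresh]
    simp only [put, exec, NExp.eval, cell_eval, Mem.setNat_real, Mem.setNat_nat_self,
      Mem.setNat_nat_of_ne _ _ _ _ _ (show 9 ≠ 12 by norm_num),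
      Mem.setNat_nat_of_ne _ _ _ _ _ (show 9 ≠ 11 by norm_num),
      Mem.setNat_nat_of_ne _ _ _ _ _ (show 10 ≠ 12 by norm_num),
      Mem.setNat_nat_of_ne _ _ _ _ _ (show 10 ≠ 11 by norm_num),
      Mem.setNat_nat_of_ne _ _ _ _ _ (show 6 ≠ 11 by norm_num), h6', h6, h9', h9, h10', h10, hR]
    refine ⟨⟨by simp [h6'], by simp [h9'], by simp [h10']⟩, by simp [hR], fun h hh => ?_,
      fun h h1 h2 h3 => ?_⟩
    · rw [Mem.setReal_row, Mem.setNat_real, Function.update_of_ne (by omega)]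
      exact hleaf h hh
    · rw [Mem.setReal_row, Mem.setNat_real, Mem.setNat_real]
      -- Nodes are processed in decreasing order, so both children of `h` are final when `h` is
      -- computed. The last turn writes only the unused cell `0`.
      by_cases hcur : h = L - (n + 1)
      · rw [← hcur, Function.update_self, Function.update_of_ne (by omega),
          Function.update_of_ne (by omega)]
      · rw [Function.update_of_ne hcur, Function.update_of_ne (by omega),
          Function.update_of_ne (by omega)]
        exact hnode h h1 (by omega) h3

theorem exec_initTree (m : Mem) {z k N d : ℕ} {p : ℕ → ℕ} (h0 : m.nat 0 0 0 0 = N)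
    (h6 : m.nat 6 0 0 0 = 2 ^ d) (h8 : ∀ y < N, m.nat 8 z y 0 = p y) (h9 : m.nat 9 0 0 0 = z)
    (h10 : m.nat 10 0 0 0 = k) (h3 : ∀ q, m.real 3 z k q = 0) :
    LazyTree.Represents ((initTree.exec m).real 3 z k) ((initTree.exec m).real 4 z k) d
      (fun q => ∑ y ∈ Finset.range N, if 2 ^ d + p y = q then m.real 5 0 0 0 else 0) := by
  rw [initTree, exec_seq, exec_seq]
  have hav : ∀ i, i = 6 ∨ i = 9 ∨ i = 10 → (fillLeaves.exec m).nat i = m.nat i ∧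
      (fillFactors.exec (fillLeaves.exec m)).nat i = m.nat i := fun i hi => by
    have h1 := nat_of_avoids (a := i) (c := fillLeaves)
      (by simp only [fillLeaves, AvoidsNat, tput, and_true]; omega) m
    refine ⟨h1, ?_⟩
    rw [nat_of_avoids (by simp only [fillFactors, AvoidsNat, tput, and_true]; omega), h1]
  have hone := exec_fillFactors (fillLeaves.exec m) (z := z) (k := k)
    (by rw [(hav 9 (by simp)).1, h9]) (by rw [(hav 10 (by simp)).1, h10])
  rw [(hav 6 (by simp)).1, h6] at hone
  have hleaf := exec_fillLeaves m h0 h6 h8 h9 h10 h3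
  have hkeep : (fillFactors.exec (fillLeaves.exec m)).real 3 = (fillLeaves.exec m).real 3 :=
    real_of_avoids (by simp [fillFactors, AvoidsReal, tput]) _
  obtain ⟨hR, hV, hnode⟩ := exec_fillNodes (fillFactors.exec (fillLeaves.exec m)) (z := z) (k := k)
    (by rw [(hav 6 (by simp)).2, h6]) (by rw [(hav 9 (by simp)).2, h9])
    (by rw [(hav 10 (by simp)).2, h10])
  rw [hR]
  have H := LazyTree.represents_of_factors_eq_one hone hnode
  refine ⟨fun q h1 h2 => ?_, H.node⟩
  rw [H.leaf q h1 h2, hV q h1, hkeep, hleaf]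

/-- The learning rate. -/
def rate (N K M T : ℕ) : ℝ :=
  min (√(3 * (M * Real.log (max N (K / M))) / (2 * (K * T)))) (1 / 2)

theorem exec_learningRate (m : Mem) :
    (learningRate.exec m).real 7 0 0 0 =
      rate (m.nat 0 0 0 0) (m.nat 1 0 0 0) (m.nat 2 0 0 0) (m.nat 3 0 0 0) := by
  rw [learningRate, exec_seq, exec_seq, exec_seq]
  set m₁ := (rput 6 (.ofNat (cell 0))).exec m with hm₁
  set m₂ := (Cmd.ite (.realLe (rcell 6) (.divide (.ofNat (cell 1)) (.ofNat (cell 2))))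
    (rput 6 (.divide (.ofNat (cell 1)) (.ofNat (cell 2)))) .skip).exec m₁ with hm₂
  have h1 : m₁.real 6 0 0 0 = m.nat 0 0 0 0 ∧ m₁.nat = m.nat := by
    simp [hm₁, rput, exec, NExp.eval, RExp.eval]
  have h2 : m₂.real 6 0 0 0 = max (m.nat 0 0 0 0 : ℝ) (m.nat 1 0 0 0 / m.nat 2 0 0 0) ∧
      m₂.nat = m.nat := by
    by_cases hle : (m.nat 0 0 0 0 : ℝ) ≤ m.nat 1 0 0 0 / m.nat 2 0 0 0
    · rw [hm₂, exec_ite_pos (by simpa [Test.holds, RExp.eval, NExp.eval, h1] using hle),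
        max_eq_right hle]
      simp [rput, exec, NExp.eval, RExp.eval, h1]
    · rw [hm₂, exec_ite_neg (by simpa [Test.holds, RExp.eval, NExp.eval, h1] using hle),
        max_eq_left (not_le.1 hle).le]
      simp [exec, h1]
  set m₃ := (rput 7 (.sqrt (.divide
    (.times (.ofNat (.const 3)) (.times (.ofNat (cell 2)) (.log (rcell 6))))
    (.times (.ofNat (.const 2)) (.times (.ofNat (cell 1)) (.ofNat (cell 3))))))).exec m₂ with hm₃
  set e := √(3 * (m.nat 2 0 0 0 * Real.log (max (m.nat 0 0 0 0) (m.nat 1 0 0 0 / m.nat 2 0 0 0))) /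
    (2 * ((m.nat 1 0 0 0 : ℝ) * m.nat 3 0 0 0))) with he
  have h3 : m₃.real 7 0 0 0 = e := by
    simp [hm₃, rput, exec, NExp.eval, RExp.eval, h2, he]
  rw [rate, ← he]
  by_cases hle : e ≤ 1 / 2
  · rw [exec_ite_pos (by simpa [Test.holds, RExp.eval, NExp.eval, h3] using hle), min_eq_left hle]
    exact h3
  · rw [exec_ite_neg (by simpa [Test.holds, RExp.eval, NExp.eval, h3] using hle),
      min_eq_right (not_le.1 hle).le]
    simp [rput, exec, NExp.eval, RExp.eval]

/-- Specification of `prepare`. -/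
theorem exec_prepare (m : Mem) {N K M T : ℕ} (h0 : m.nat 0 0 0 0 = N) (h1 : m.nat 1 0 0 0 = K)
    (h2 : m.nat 2 0 0 0 = M) (h3 : m.nat 3 0 0 0 = T) (hN : 1 ≤ N) (h7 : m.nat 7 0 0 0 = 0)
    (h8 : ∀ z x, m.nat 8 z x 0 = 0) (hr3 : ∀ z k q, m.real 3 z k q = 0) :
    ∃ d, N ≤ 2 ^ d ∧ 2 ^ d < 2 * N ∧
      Ready N K d (rankOf (fun i j => m.real 0 i j 0) N) (rate N K M T)
        (fun z _ q => ∑ y ∈ Finset.range N,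
          if 2 ^ d + rankOf (fun i j => m.real 0 i j 0) N z y = q then
            (M : ℝ) / (K * (N * N)) else 0) (prepare.exec m) := by
  obtain ⟨d, h6, hd7, hle, hlt⟩ := exec_sizes m (by omega) h7
  rw [h0] at hle hlt
  refine ⟨d, hle, hlt, ?_⟩
  set p := rankOf (fun i j => m.real 0 i j 0) N with hp
  set m₁ := sizes.exec m with hm₁
  have hn1 : ∀ i, i ≠ 6 → i ≠ 7 → i ≠ 9 → m₁.nat i = m.nat i := fun i _ _ _ =>
    nat_of_avoids (by simp only [sizes, AvoidsNat, put, true_and]; omega) m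
  have hr1 : m₁.real = m.real := funext fun i =>
    real_of_avoids (by simp [sizes, AvoidsReal, put]) m
  set m₂ := ranks.exec m₁ with hm₂
  have hn2 : ∀ i, i < 8 → m₂.nat i = m₁.nat i := fun i _ =>
    nat_of_avoids (by simp only [ranks, AvoidsNat, true_and]; omega) m₁
  have hr2 : m₂.real = m₁.real := funext fun i =>
    real_of_avoids (by simp [ranks, AvoidsReal]) m₁
  have h82 : ∀ z < N, ∀ x < N, m₂.nat 8 z x 0 = p z x := by
    have := exec_ranks m₁ (N := N) (by rw [hn1 0 (by simp) (by simp) (by simp), h0])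
      (by rw [hn1 8 (by simp) (by simp) (by simp)]; exact h8)
    rwa [hr1] at this
  have low : ∀ i, i ≤ 3 → m₂.nat i = m.nat i := fun i _ => by
    rw [hn2 i (by omega), hn1 i (by omega) (by omega) (by omega)]
  set m₃ := initialWeight.exec m₂ with hm₃
  have hn3 : m₃.nat = m₂.nat := rfl
  have hr3' : m₃.real 3 = m.real 3 := by
    rw [real_of_avoids (by simp [initialWeight, AvoidsReal, rput]), hr2, hr1]
  have h5 : m₃.real 5 0 0 0 = (M : ℝ) / (K * (N * N)) := by
    simp [hm₃, initialWeight, rput, exec, NExp.eval, RExp.eval, low, h0, h1, h2]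
  set m₄ := (forTrees initTree).exec m₃ with hm₄
  have hn4 : ∀ i, i ≤ 8 → m₄.nat i = m₂.nat i := fun i _ =>
    nat_of_avoids (by
      simp only [forTrees, initTree, fillLeaves, fillFactors, fillNodes, AvoidsNat, tput, put,
        refresh, and_true]
      omega) m₃
  have trees := exec_forTrees (c := initTree)
    (by simp [initTree, fillLeaves, fillFactors, fillNodes, TreeLocal, put, tput, refresh])
    (by simp [initTree, fillLeaves, fillFactors, fillNodes, AvoidsNat, put, tput, refresh]) m₃
    (fun z k V R => LazyTree.Represents V R d (fun q => ∑ y ∈ Finset.range N,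
      if 2 ^ d + p z y = q then (M : ℝ) / (K * (N * N)) else 0)) ?_
  · rw [hn3, low 0 (by simp), low 1 (by simp), h0, h1] at trees
    have hfin : prepare.exec m = learningRate.exec m₄ := rfl
    have hn5 : (learningRate.exec m₄).nat = m₄.nat := funext fun i =>
      nat_of_avoids (by simp [learningRate, AvoidsNat, rput]) m₄
    have hr5 : ∀ i, i = 3 ∨ i = 4 → (learningRate.exec m₄).real i = m₄.real i := fun i _ =>
      real_of_avoids (by
        simp only [learningRate, AvoidsReal, rput, and_true, true_and]; omega) m₄
    rw [hfin]
    refine ⟨?_, ?_, ?_, ?_, ?_, ?_, ?_⟩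
    · rw [hn5, hn4 0 (by simp), low 0 (by simp), h0]
    · rw [hn5, hn4 1 (by simp), low 1 (by simp), h1]
    · rw [hn5, hn4 6 (by simp), hn2 6 (by simp), h6]
    · rw [hn5, hn4 7 (by simp), hn2 7 (by simp), hd7]
    · rw [hn5, hn4 8 (by simp)]; exact h82
    · rw [exec_learningRate, hn4 0 (by simp), hn4 1 (by simp), hn4 2 (by simp), hn4 3 (by simp),
        low 0 (by simp), low 1 (by simp), low 2 (by simp), low 3 (by simp), h0, h1, h2, h3]
    · rw [hr5 3 (by simp), hr5 4 (by simp)]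
      exact trees
  · intro z hz k hk m' hN' hR h9 h10 h3' h4'
    rw [hn3, low 0 (by simp), h0] at hz
    have hav : ∀ i, i = 0 ∨ i = 6 ∨ i = 8 → m'.nat i = m₂.nat i := fun i hi =>
      hN' i (by omega) (by omega) (by
        simp only [initTree, fillLeaves, fillFactors, fillNodes, AvoidsNat, tput, put, refresh,
          and_true]
        omega)
    have := exec_initTree m' (N := N) (d := d) (p := p z) (z := z) (k := k)
      (by rw [hav 0 (by simp), low 0 (by simp), h0])
      (by rw [hav 6 (by simp), hn2 6 (by simp), h6])
      (fun y hy => by rw [hav 8 (by simp), h82 z hz y hy]) h9 h10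
      (fun q => by rw [h3', hr3', hr3])
    rwa [hR 5 (by
      simp [initTree, fillLeaves, fillFactors, fillNodes, AvoidsReal, tput, put, refresh]),
      h5] at this

/-! ### Running time of one trial. -/

theorem choose_loopsOver : choose.LoopsOver {0, 1, 7} := by
  simp only [choose, sumQueries, query, ascend, put, rput, eput, LoopsOver, cell_eval, and_true,
    true_and, Finset.mem_insert, Finset.mem_singleton]
  refine ⟨⟨?_, ?_, ?_⟩, ?_⟩ <;> intro m m' h
  · rw [h 1 (by simp)]
  · rw [h 0 (by simp)]
  · rw [h 7 (by simp)]
  · rw [h 1 (by simp)]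

theorem learn_loopsOver : learn.LoopsOver {0, 1, 7} := by
  simp only [learn, factors, forTrees, rescale, refresh, ascend, put, eput, tput, LoopsOver,
    cell_eval, and_true, true_and, Finset.mem_insert, Finset.mem_singleton]
  refine ⟨?_, ?_, ?_, ?_⟩ <;> intro m m' h
  · rw [h 1 (by simp)]
  · rw [h 0 (by simp)]
  · rw [h 1 (by simp)]
  · rw [h 7 (by simp)]

theorem choose_time (m : Mem) : choose.time m ≤
    34 + m.nat 1 0 0 0 * (53 + m.nat 0 0 0 0 * (64 + m.nat 7 0 0 0 * 100)) := by
  refine (time_le_staticTime choose_loopsOver (by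
    simp [choose, sumQueries, query, ascend, put, rput, eput, AvoidsNat]) m
    fun _ _ => rfl).trans_eq ?_
  simp only [choose, sumQueries, query, ascend, put, rput, eput, staticTime, NExp.cost, RExp.cost,
    Test.cost, cell, rcell, entry, tree, leafOf, left, right, NExp.eval]
  ring

theorem learn_time (m : Mem) : learn.time m ≤
    48 + m.nat 1 0 0 0 * 18 + m.nat 0 0 0 0 * (6 + m.nat 1 0 0 0 * (61 + m.nat 7 0 0 0 * 137)) := by
  refine (time_le_staticTime learn_loopsOver (by
    simp [learn, factors, forTrees, rescale, refresh, ascend, put, tput, eput, AvoidsNat]) m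
    fun _ _ => rfl).trans_eq ?_
  simp only [learn, factors, forTrees, rescale, refresh, ascend, put, eput, tput, staticTime,
    NExp.cost, RExp.cost, Test.cost, cell, rcell, entry, tree, leafOf, left, right, NExp.eval]
  ring

theorem Ready.time_le {N K d : ℕ} {p : ℕ → ℕ → ℕ} {η : ℝ} {a a' : ℕ → ℕ → ℕ → ℝ} {m m' : Mem}
    (h : Ready N K d p η a m) (h' : Ready N K d p η a' m') (hN : 1 ≤ N) (hK : 1 ≤ K) :
    choose.time m + (K + 1) + learn.time m' ≤ K * N * (300 + 240 * d) := by
  have h1 := choose_time m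
  have h2 := learn_time m'
  rw [h.contexts, h.actions, h.depth] at h1
  rw [h'.contexts, h'.actions, h'.depth] at h2
  have e1 : 1 ≤ K * N := Nat.mul_pos hK hN
  have e2 : K ≤ K * N := Nat.le_mul_of_pos_right K hN
  have e3 : N ≤ K * N := Nat.le_mul_of_pos_left N hK
  -- Bounding `1`, `K` and `N` by `K * N`, the total is at most `K * N * (286 + 237 * d)`.
  nlinarith [Nat.zero_le (K * N * d)]

/-- Since `log 2 ≤ log N`, the constant 300 is at most `300 / log 2 * log N`, and `d ≤ 2 * log N /
log 2`. The sum of coefficients is `780 / log 2 < 1200`. -/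
theorem depth_le_log {N d : ℕ} (hN : 2 ≤ N) (hd : 2 ^ d < 2 * N) :
    (300 + 240 * d : ℝ) ≤ 1200 * Real.log N := by
  have h2 := Real.log_two_gt_d9
  have hN' : (2 : ℝ) ≤ N := by exact_mod_cast hN
  have h3 : Real.log 2 ≤ Real.log N := Real.log_le_log (by norm_num) hN'
  have h4 : (d : ℝ) * Real.log 2 ≤ Real.log 2 + Real.log N := by
    rw [← Real.log_pow, ← Real.log_mul (by norm_num) (by linarith)]
    refine Real.log_le_log (by positivity) ?_
    exact_mod_cast hd.le
  nlinarith [Nat.cast_nonneg (α := ℝ) d]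

end Prog

/-! ### Choice of parameters and the resulting reward bound. -/

theorem rate_mem {X : Type*} [Fintype X] {K M T : ℕ} (hX : 2 ≤ Fintype.card X) (hK : 1 ≤ K)
    (hM : 1 ≤ M) (hT : 1 ≤ T) :
    0 < Prog.rate (Fintype.card X) K M T ∧ Prog.rate (Fintype.card X) K M T < 1 := by
  refine ⟨lt_min (Real.sqrt_pos.2 ?_) (by norm_num),
    (min_le_right _ _).trans_lt (by norm_num)⟩
  have : 0 < Real.log (max (Fintype.card X : ℝ) ((K : ℝ) / M)) := by
    refine Real.log_pos (lt_max_of_lt_left ?_)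
    exact_mod_cast hX
  positivity

theorem sum_range_card {X : Type*} [Fintype X] (lab : X ≃ Fin (Fintype.card X)) (F : ℕ → ℝ) :
    ∑ i ∈ Finset.range (Fintype.card X), F i = ∑ z : X, F (lab z) := by
  rw [Finset.sum_range]
  exact (Equiv.sum_comp lab fun i : Fin _ => F i).symm

section Link

variable {X : Type*} [Fintype X] [MetricSpace X] {K : ℕ}

open Classical in
/-- Number of pairs of points that describe the ball. -/
def multiplicity (B : Ball X) : ℝ :=
  ((Finset.univ.filter fun v : X × X => ballThrough v.1 v.2 = B).card : ℝ)

theorem one_le_multiplicity (B : Ball X) : 1 ≤ multiplicity B := by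
  classical
  obtain ⟨z, y, h⟩ := B.exists_eq_ballThrough
  unfold multiplicity
  exact_mod_cast Finset.card_pos.2 ⟨(z, y), by simp [h]⟩

theorem multiplicity_pos (B : Ball X) : 0 < multiplicity B :=
  zero_lt_one.trans_le (one_le_multiplicity B)

/-- Grouping the pairs by the ball they describe: each ball occurs `multiplicity` times, which
cancels the division and is never zero. -/
theorem sum_ballThrough (f : Ball X → ℝ) :
    ∑ z : X, ∑ y : X, f (ballThrough z y) / multiplicity (ballThrough z y) = ∑ B, f B := by
  classical
  rw [← Fintype.sum_prod_type' (f := fun z y : X =>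
    f (ballThrough z y) / multiplicity (ballThrough z y)),
    ← Finset.sum_fiberwise Finset.univ fun v : X × X => ballThrough v.1 v.2]
  refine Finset.sum_congr rfl fun B _ => ?_
  rw [Finset.sum_congr rfl fun v hv => by rw [(Finset.mem_filter.1 hv).2], Finset.sum_const,
    nsmul_eq_mul]
  exact mul_div_cancel₀ _ (multiplicity_pos B).ne'

theorem sum_multiplicity : ∑ B : Ball X, multiplicity B = (Fintype.card X : ℝ) * Fintype.card X := by
  rw [← sum_ballThrough]
  simp [div_self (multiplicity_pos _).ne']

/-- The initial weights. -/
def initialWeights (M : ℕ) (i : Ball X × Fin K) : ℝ :=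
  (M : ℝ) / (K * (Fintype.card X * Fintype.card X)) * multiplicity i.1

open Classical in
theorem sum_initialWeights (hX : 0 < Fintype.card X) (hK : 1 ≤ K) (M : ℕ) :
    ∑ i : Ball X × Fin K, initialWeights M i = M := by
  unfold initialWeights
  rw [← Finset.mul_sum, Fintype.sum_prod_type]
  simp only [Finset.sum_const, Finset.card_univ, Fintype.card_fin, nsmul_eq_mul]
  rw [← Finset.mul_sum, sum_multiplicity]
  have : (K : ℝ) ≠ 0 := by positivity
  have : (Fintype.card X : ℝ) ≠ 0 := by positivity
  field_simp

theorem initialWeights_pos {M : ℕ} (hX : 0 < Fintype.card X) (hK : 1 ≤ K) (hM : 1 ≤ M)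
    (i : Ball X × Fin K) : 0 < initialWeights M i := by
  have := multiplicity_pos i.1
  unfold initialWeights
  positivity

theorem divergence_initialWeights_le {M : ℕ} (hX : 2 ≤ Fintype.card X) (hK : 1 ≤ K) (hM : 1 ≤ M)
    (B : Fin M → Ball X) (b : Fin M → Fin K) :
    divergence B b (initialWeights M) ≤
      3 * (M * Real.log (max (Fintype.card X : ℝ) ((K : ℝ) / M))) := by
  set N : ℝ := (Fintype.card X : ℝ) with hN
  have hN2 : (2 : ℝ) ≤ N := by rw [hN]; exact_mod_cast hX
  have hK0 : (0 : ℝ) < K := by positivity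
  have hM0 : (0 : ℝ) < M := by positivity
  set L := max N ((K : ℝ) / M) with hL
  have hLN : N ≤ L := le_max_left _ _
  have hc : 0 < (M : ℝ) / (K * (N * N)) := by positivity
  have h1 : ∀ j, -Real.log (initialWeights M (B j, b j)) - 1 ≤ 3 * Real.log L - 1 := by
    intro j
    have h2 : Real.log ((M : ℝ) / (K * (N * N))) ≤ Real.log (initialWeights M (B j, b j)) :=
      Real.log_le_log hc (le_mul_of_one_le_right hc.le (one_le_multiplicity _))
    -- The inverse of the smallest possible initial weight is `(K / M) * N * N ≤ L ^ 3`. This is why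
    -- the logarithm involves `max N (K / M)`.
    have h3 : -Real.log ((M : ℝ) / (K * (N * N))) ≤ 3 * Real.log L := by
      rw [← Real.log_inv, ← Nat.cast_ofNat, ← Real.log_pow]
      refine Real.log_le_log (inv_pos.2 hc) ?_
      rw [inv_div, show (K : ℝ) * (N * N) / M = K / M * (N * N) by ring,
        show L ^ 3 = L * (L * L) by ring]
      exact mul_le_mul (le_max_right _ _) (mul_le_mul hLN hLN (by linarith) (by linarith))
        (by positivity) (by linarith)
    linarith
  unfold divergence
  -- The total weight `M` cancels the `M` terms `-1` exactly.
  rw [sum_initialWeights (by omega) hK]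
  refine (add_le_add_left (Finset.sum_le_sum fun j _ => h1 j) _).trans_eq ?_
  simp
  ring

/-- Reward bound for CBA with the parameters that the program uses. -/
theorem expectedReward_ge {M T : ℕ} (hX : 2 ≤ Fintype.card X) (hK : 1 ≤ K) (hM : 1 ≤ M)
    (hT : 1 ≤ T) (x : ℕ → X) (r : ℕ → Fin K → ℝ)
    (hr : ∀ t < T, ∀ a, r t a ∈ Set.Icc (-1 : ℝ) 1) (B : Fin M → Ball X) (b : Fin M → Fin K)
    (hB : ∀ i j, i ≠ j → Disjoint (B i).1 (B j).1) [∀ t j, Decidable (x t ∈ (B j).1)] :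
    (∑ t ∈ Finset.range T, ∑ j : Fin M, if x t ∈ (B j).1 then r t (b j) else 0) -
        √(4 * M * Real.log (max (Fintype.card X : ℝ) ((K : ℝ) / M)) * (6 * K + 1) * T) ≤
      (algorithm (Prog.rate (Fintype.card X) K M T) (initialWeights (K := K) M)
        ballExpert).expectedReward x r T := by
  have hw := initialWeights_pos (X := X) (K := K) (M := M) (by omega) hK hM
  set comp := ∑ t ∈ Finset.range T, ∑ j : Fin M, if x t ∈ (B j).1 then r t (b j) else 0 with hcomp
  set l := Real.log (max (Fintype.card X : ℝ) ((K : ℝ) / M)) with hl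
  have hl0 : 0 < l := by
    refine Real.log_pos (lt_max_of_lt_left ?_)
    exact_mod_cast hX
  have hK1 : (1 : ℝ) ≤ K := by exact_mod_cast hK
  have hM1 : (1 : ℝ) ≤ M := by exact_mod_cast hM
  have hT1 : (1 : ℝ) ≤ T := by exact_mod_cast hT
  have hMl : 0 < M * l := by positivity
  set e := √(3 * (M * l) / (2 * (K * T))) with he
  have hrate : Prog.rate (Fintype.card X) K M T = min e (1 / 2) := rfl
  rw [hrate]
  -- Below this threshold the error term is at least `2 * T`, and rewards in `[-1, 1]` suffice.
  -- Above it, `6 * M * l ≤ K * T`, so the cap `1 / 2` in the learning rate is inactive.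
  rcases le_total (T : ℝ) (M * l * (6 * K + 1)) with hcase | hcase
  · have h1 : comp ≤ T := by
      have : ∀ t ∈ Finset.range T, (∑ j : Fin M, if x t ∈ (B j).1 then r t (b j) else 0) ≤ 1 := by
        intro t ht
        refine (Finset.sum_le_sum fun j _ => ?_).trans (card_containing_le_one hB (x t))
        split_ifs
        · exact (hr t (Finset.mem_range.1 ht) _).2
        · exact le_rfl
      refine (Finset.sum_le_sum this).trans_eq ?_
      simp
    have h2 := expectedFrom_ge_neg (initialWeights (K := K) M) (η := min e (1 / 2)) x r T 0 _ hw
      (by simpa using hr)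
    have h3 : 2 * (T : ℝ) ≤ √(4 * M * l * (6 * K + 1) * T) := by
      refine Real.le_sqrt_of_sq_le ?_
      nlinarith
    change _ ≤ (algorithm (min e (1 / 2)) (initialWeights (K := K) M) ballExpert).expectedFrom
      x r T 0 (initialWeights M)
    linarith
  · have hTK : (T : ℝ) ≤ K * T := le_mul_of_one_le_left (by linarith) hK1
    have he2 : e ^ 2 = 3 * (M * l) / (2 * (K * T)) := Real.sq_sqrt (by positivity)
    have he0 : 0 < e := Real.sqrt_pos.2 (by positivity)
    have hhalf : e ≤ 1 / 2 := by
      refine Real.sqrt_le_iff.2 ⟨by norm_num, ?_⟩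
      rw [div_le_iff₀ (by positivity)]
      nlinarith
    rw [min_eq_left hhalf]
    have h1 := expectedFrom_ge b hB (initialWeights (K := K) M) he0 (by linarith) x r T 0 _ hw
      (by simpa using hr)
    have hdiv := divergence_initialWeights_le hX hK hM B b
    -- The rate `e` equates `3 * M * l / e` with `2 * K * T * e`. Twice this value squares to `24 *
    -- K * M * l * T`, below the stated `4 * M * l * (6 * K + 1) * T`.
    have h2 : divergence B b (initialWeights M) / e ≤ 2 * (K * T) * e := by
      rw [div_le_iff₀ he0, mul_assoc, ← sq, he2, mul_div_cancel₀ _ (by positivity)]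
      exact hdiv
    have h3 : 2 * (2 * (K * T) * e) ≤ √(4 * M * l * (6 * K + 1) * T) := by
      refine Real.le_sqrt_of_sq_le ?_
      have : (2 * (2 * (K * T) * e)) ^ 2 = 24 * K * (M * l) * T := by
        rw [mul_pow, mul_pow, he2]
        field_simp
        ring
      rw [this]
      nlinarith [mul_pos hMl (by linarith : (0 : ℝ) < T)]
    have h4 : (∑ t' ∈ Finset.range T, ∑ j, if x (0 + t') ∈ (B j).1 then
        r (0 + t') (b j) else 0) = comp := by
      simp only [zero_add, hcomp]
    change _ ≤ (algorithm e (initialWeights (K := K) M) ballExpert).expectedFrom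
      x r T 0 (initialWeights M)
    simp only [zero_add] at h1 h4
    have h5 : (T : ℝ) * (2 * K * e) = 2 * (K * T) * e := by ring
    rw [h5] at h1
    refine le_trans ?_ h1
    refine le_trans (b := comp - 2 * (2 * (K * T) * e)) (by linarith) ?_
    have h6 : comp = ∑ t ∈ Finset.range T, @Finset.sum (Fin M) ℝ _ Finset.univ fun j =>
        @ite _ (x t ∈ (B j).1) (Classical.propDecidable _) (r t (b j)) 0 := by
      rw [hcomp]
      refine Finset.sum_congr rfl fun t _ => Finset.sum_congr rfl fun j _ => ?_
      congr
    rw [h6]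
    linarith

/-! ### The program simulates the algorithm -/

variable (lab : X ≃ Fin (Fintype.card X))

/-- Rank of the point `x` in the tree with centre `z`, by the numbers of the points. -/
def labRank (z x : ℕ) : ℕ :=
  Prog.rankOf (fun i j => (inputMem lab 0 0 0).real 0 i j 0) (Fintype.card X) z x

theorem labRank_lt {z x : ℕ} (hx : x < Fintype.card X) : labRank lab z x < Fintype.card X :=
  Prog.rankOf_lt _ hx

theorem labRank_le_iff (z x y : X) :
    labRank lab (lab z) (lab x) ≤ labRank lab (lab z) (lab y) ↔ x ∈ (ballThrough z y).1 := by
  rw [labRank, labRank, Prog.rankOf_le_iff _ (lab y).isLt, mem_ballThrough]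
  simp [inputMem]

open Classical in
/-- The leaf weights `a` represent the weights `w` of CBA. -/
def Linked (d : ℕ) (a : ℕ → ℕ → ℕ → ℝ) (w : Ball X × Fin K → ℝ) : Prop :=
  ∀ (z : X) (k : Fin K) (q : ℕ), a (lab z) k q =
    ∑ y : X, if 2 ^ d + labRank lab (lab z) (lab y) = q then
      w (ballThrough z y, k) / multiplicity (ballThrough z y) else 0

variable {lab}

/-- Membership of `x` in `ballThrough z y` is a comparison of ranks, hence a condition on the leaf
of `y`. Exchanging sums leaves the shared weights of the pairs, which `sum_ballThrough` reassembles
into balls. -/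
theorem Linked.total_eq {d : ℕ} {a : ℕ → ℕ → ℕ → ℝ} {w : Ball X × Fin K → ℝ}
    (h : Linked lab d a w) (hd : Fintype.card X ≤ 2 ^ d) (x : X) (k : Fin K) :
    Prog.total (Fintype.card X) d (labRank lab) a (lab x) k = activeWeight x w k := by
  classical
  unfold Prog.total activeWeight
  rw [sum_range_card lab, ← sum_ballThrough]
  refine Finset.sum_congr rfl fun z _ => ?_
  simp only [h z k]
  have hpull : ∀ (c : Prop) [Decidable c] (f : X → ℝ),
      (if c then ∑ y, f y else 0) = ∑ y, if c then f y else 0 := by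
    intro c _ f
    split_ifs <;> simp
  have h1 : ∀ q : ℕ, (if 2 ^ d + labRank lab (lab z) (lab x) ≤ q then
      ∑ y : X, (if 2 ^ d + labRank lab (lab z) (lab y) = q then
        w (ballThrough z y, k) / multiplicity (ballThrough z y) else 0) else 0) =
      ∑ y : X, if 2 ^ d + labRank lab (lab z) (lab y) = q then
        (if x ∈ (ballThrough z y).1 then w (ballThrough z y, k) else 0) /
          multiplicity (ballThrough z y) else 0 := by
    intro q
    rw [hpull]
    refine Finset.sum_congr rfl fun y _ => ?_
    rw [← labRank_le_iff lab]
    by_cases hq : 2 ^ d + labRank lab (lab z) (lab y) = q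
    · subst hq
      simp only [add_le_add_iff_left, if_true, ite_div, zero_div]
    · simp [hq]
  simp only [h1]
  rw [Finset.sum_comm]
  refine Finset.sum_congr rfl fun y _ => ?_
  rw [Finset.sum_ite_eq, if_pos]
  have := labRank_lt lab (z := lab z) (lab y).isLt
  rw [Finset.mem_Ico, pow_succ]
  omega

theorem Linked.scale_eq {d : ℕ} {a : ℕ → ℕ → ℕ → ℝ} {w : Ball X × Fin K → ℝ}
    (h : Linked lab d a w) (hd : Fintype.card X ≤ 2 ^ d) (x : X) :
    max 1 (∑ k ∈ Finset.range K, Prog.total (Fintype.card X) d (labRank lab) a (lab x) k) =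
      scale x w := by
  rw [scale, Finset.sum_range]
  simp only [h.total_eq hd]

/-- Here `multiplicity` cancels: every pair starts with the same constant, which the program can
compute without comparing balls. -/
theorem linked_initialWeights {d M : ℕ} :
    Linked (K := K) lab d (fun z _ q => ∑ y ∈ Finset.range (Fintype.card X),
      if 2 ^ d + labRank lab z y = q then
        (M : ℝ) / (K * ((Fintype.card X : ℝ) * Fintype.card X)) else 0) (initialWeights M) := by
  classical
  intro z k q
  dsimp only
  rw [sum_range_card lab]
  refine Finset.sum_congr rfl fun y _ => ?_
  rw [initialWeights, mul_div_cancel_right₀ _ (multiplicity_pos _).ne']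

/-- All points on one leaf describe the same ball around `z`, so their shares get the same factor
and one multiplication per leaf suffices. -/
theorem Linked.nextWeights {d : ℕ} {a : ℕ → ℕ → ℕ → ℝ} {w : Ball X × Fin K → ℝ}
    (h : Linked lab d a w) (η : ℝ) (x : X) (o : Option (Fin K)) (rew : ℝ) (s : ℕ → ℝ)
    (hs : ∀ k : Fin K, s k = mixture (ballExpert x) w k) :
    Linked lab d (fun z k q => a z k q * if 2 ^ d + labRank lab z (lab x) ≤ q then
      Real.exp (η * (1 - if k = o.elim K (fun b => (b : ℕ)) then (1 - rew) / s k else 0)) /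
        scale x w else 1) (nextWeights η (ballExpert x) w o rew) := by
  classical
  intro z k q
  dsimp only
  rw [h z k q, Finset.sum_mul]
  refine Finset.sum_congr rfl fun y _ => ?_
  by_cases hq : 2 ^ d + labRank lab (lab z) (lab y) = q
  · subst hq
    -- Abstention is coded by `K`, which no action index `k < K` equals.
    have ho : ((k : ℕ) = o.elim K fun b => (b : ℕ)) ↔ o = some k := by
      cases o with
      | none => simp [k.isLt.ne]
      | some b => simp [Fin.ext_iff, eq_comm]
    rw [nextWeights_ballExpert, estimate, hs]
    simp only [if_true, add_le_add_iff_left, labRank_le_iff, ho]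
    split_ifs <;> ring
  · simp [hq]

/-- The program. -/
def program : Program := ⟨Prog.prepare, Prog.choose, Prog.learn⟩

variable (lab) in
/-- The memory `m` represents the weights `w`. -/
def Simulates (d : ℕ) (η : ℝ) (m : Mem) (w : Ball X × Fin K → ℝ) : Prop :=
  ∃ a, Prog.Ready (Fintype.card X) K d (labRank lab) η a m ∧ Linked lab d a w

section

variable {d : ℕ} {η : ℝ} {m : Mem} {w : Ball X × Fin K → ℝ}

theorem Simulates.chosen (h : Simulates lab d η m w) (hd : Fintype.card X ≤ 2 ^ d) (x : X) :
    Simulates lab d η (program.chosen lab m x) w ∧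
    (program.chosen lab m x).nat 4 0 0 0 = lab x ∧
    (program.chosen lab m x).real 6 0 0 0 = scale x w ∧
    ∀ k : Fin K, (program.chosen lab m x).real 1 k 0 0 = mixture (ballExpert x) w k := by
  obtain ⟨a, hready, hlink⟩ := h
  have hready' : Prog.Ready (Fintype.card X) K d (labRank lab) η a
      (Program.withContext lab m x) :=
    hready.congr (fun i hi => Mem.setNat_nat_of_ne _ _ _ _ _ (by omega)) fun i _ => rfl
  obtain ⟨h1, h2, h3, h4⟩ := hready'.exec_choose
    (fun z _ v hv => (labRank_lt lab hv).trans_le hd) (lab x).isLt (by simp [Program.withContext])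
  rw [hlink.scale_eq hd] at h3 h4
  refine ⟨⟨a, h1, hlink⟩, h2, h3, fun k => ?_⟩
  rw [mixture_ballExpert, ← hlink.total_eq hd]
  exact h4 k k.isLt

theorem Simulates.feedback (h : Simulates lab d η m w) (o : Option (Fin K)) (rew : ℝ) :
    Simulates lab d η (Program.withFeedback m o rew) w := by
  obtain ⟨a, hready, hlink⟩ := h
  exact ⟨a, hready.congr (fun i hi => Mem.setNat_nat_of_ne _ _ _ _ _ (by omega))
    fun i hi => Mem.setReal_real_of_ne _ _ _ _ _ (by omega), hlink⟩

theorem Simulates.update (h : Simulates lab d η m w) (hd : Fintype.card X ≤ 2 ^ d) (x : X)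
    (o : Option (Fin K)) (rew : ℝ) :
    Simulates lab d η (program.learn.exec (Program.withFeedback (program.chosen lab m x) o rew))
      (nextWeights η (ballExpert x) w o rew) := by
  obtain ⟨h1, h4, h6, hs⟩ := h.chosen hd x
  obtain ⟨a, hready, hlink⟩ := h1.feedback o rew
  have hlearn := hready.exec_learn (fun z _ v hv => (labRank_lt lab hv).trans_le hd)
    (x := lab x) (lab x).isLt (by simpa [Program.withFeedback] using h4)
    (b := o.elim K fun b => (b : ℕ)) (by simp [Program.withFeedback])
  have e2 : (Program.withFeedback (program.chosen lab m x) o rew).real 2 0 0 0 = rew := by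
    simp [Program.withFeedback]
  have e1 : (Program.withFeedback (program.chosen lab m x) o rew).real 1 =
      (program.chosen lab m x).real 1 := by
    simp [Program.withFeedback]
  have e6 : (Program.withFeedback (program.chosen lab m x) o rew).real 6 =
      (program.chosen lab m x).real 6 := by
    simp [Program.withFeedback]
  rw [e1, e2, e6, h6] at hlearn
  exact ⟨_, hlearn, hlink.nextWeights η x o rew
    (fun k => (program.chosen lab m x).real 1 k 0 0) hs⟩

end

theorem simulates_start {M T : ℕ} (hX : 2 ≤ Fintype.card X) :
    ∃ d, Fintype.card X ≤ 2 ^ d ∧ 2 ^ d < 2 * Fintype.card X ∧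
      Simulates (K := K) lab d (Prog.rate (Fintype.card X) K M T)
        (program.learner lab K M T).start (initialWeights M) := by
  obtain ⟨d, h1, h2, hready⟩ := Prog.exec_prepare (inputMem lab K M T)
    (N := Fintype.card X) (K := K) (M := M) (T := T) (by simp [inputMem]) (by simp [inputMem])
    (by simp [inputMem]) (by simp [inputMem]) (by omega) (by simp [inputMem]) (by simp [inputMem])
    (by simp [inputMem])
  -- The distance matrix in `inputMem` does not depend on `K`, `M`, `T`, so the computed ranks are
  -- definitionally those of `labRank`.
  exact ⟨d, h1, h2, _, hready, linked_initialWeights⟩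

theorem simulates_stateAfter {d M T : ℕ} {η : ℝ} {w₁ : Ball X × Fin K → ℝ}
    (hd : Fintype.card X ≤ 2 ^ d)
    (hstart : Simulates lab d η (program.learner lab K M T).start w₁)
    (h : List (X × Option (Fin K) × ℝ)) :
    Simulates lab d η ((program.learner lab K M T).stateAfter h)
      ((algorithm η w₁ ballExpert).stateAfter h) := by
  induction h using List.reverseRecOn with
  | nil => exact hstart
  | append_singleton h z ih =>
    simp only [Learner.stateAfter, List.foldl_append, List.foldl_cons, List.foldl_nil]
    exact ih.update hd z.1 z.2.1 z.2.2

theorem stateAfter_pos {η : ℝ} {w₁ : Ball X × Fin K → ℝ} (hw : ∀ i, 0 < w₁ i)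
    (h : List (X × Option (Fin K) × ℝ)) :
    ∀ i, 0 < (algorithm η w₁ ballExpert).stateAfter h i := by
  induction h using List.reverseRecOn with
  | nil => exact hw
  | append_singleton h z ih =>
    simp only [Learner.stateAfter, List.foldl_append, List.foldl_cons, List.foldl_nil]
    exact nextWeights_pos ih _ _

theorem Simulates.time_le {d : ℕ} {η : ℝ} {m : Mem} {w : Ball X × Fin K → ℝ}
    (h : Simulates lab d η m w) (hd : Fintype.card X ≤ 2 ^ d) (hd' : 2 ^ d < 2 * Fintype.card X)
    (hX : 2 ≤ Fintype.card X) (hK : 1 ≤ K) (x : X) (o : Option (Fin K)) (rew : ℝ) :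
    (program.trialTime lab m x o rew : ℝ) ≤
      1200 * ((K : ℝ) * (Fintype.card X : ℝ) * Real.log (Fintype.card X : ℝ)) := by
  obtain ⟨a, hready, -⟩ := id h
  obtain ⟨a', hready', -⟩ := (h.chosen hd x).1.feedback o rew
  have hready₁ : Prog.Ready (Fintype.card X) K d (labRank lab) η a
      (Program.withContext lab m x) :=
    hready.congr (fun i hi => Mem.setNat_nat_of_ne _ _ _ _ _ (by omega)) fun i _ => rfl
  have h1 : (program.trialTime lab m x o rew : ℝ) ≤
      K * Fintype.card X * (300 + 240 * d) := by
    exact_mod_cast hready₁.time_le hready' (by omega) hK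
  have h2 := mul_le_mul_of_nonneg_left (Prog.depth_le_log hX hd')
    (by positivity : (0 : ℝ) ≤ K * Fintype.card X)
  linarith

end Link

end CBA
end

open Classical in
theorem theorem2 :
    ∃ (A : CBA.Program) (C : ℝ),
      ∀ (X : Type*) [Fintype X] [MetricSpace X] (K M T : ℕ),
        2 ≤ Fintype.card X → 1 ≤ K → 1 ≤ M → 1 ≤ T →
        ∀ lab : X ≃ Fin (Fintype.card X),
          -- the program implements CBA on the experts (ball, action), for some parameters
          (∃ (η : ℝ) (w₁ : CBA.Ball X × Fin K → ℝ), 0 < η ∧ η < 1 ∧ (∀ i, 0 < w₁ i) ∧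
            ∀ (h : List (X × Option (Fin K) × ℝ)) (x : X),
              (A.learner lab K M T).predict ((A.learner lab K M T).stateAfter h) x =
                (CBA.algorithm η w₁ CBA.ballExpert).predict
                  ((CBA.algorithm η w₁ CBA.ballExpert).stateAfter h) x) ∧
          -- every vector that it outputs is a stochastic action
          (∀ (h : List (X × Option (Fin K) × ℝ)) (x : X),
            CBA.IsStochasticAction
              ((A.learner lab K M T).predict ((A.learner lab K M T).stateAfter h) x)) ∧
          -- per-trial time
          (∀ (h : List (X × Option (Fin K) × ℝ)) (x : X) (a : Option (Fin K)) (rew : ℝ),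
            (A.trialTime lab ((A.learner lab K M T).stateAfter h) x a rew : ℝ) ≤
              C * ((K : ℝ) * (Fintype.card X : ℝ) * Real.log (Fintype.card X : ℝ))) ∧
          -- reward bound
          (∀ (x : ℕ → X) (r : ℕ → Fin K → ℝ), (∀ t < T, ∀ a, r t a ∈ Set.Icc (-1 : ℝ) 1) →
            ∀ (B : Fin M → CBA.Ball X) (b : Fin M → Fin K),
              (∀ i j, i ≠ j → Disjoint (B i).1 (B j).1) →
              (∑ t ∈ Finset.range T, ∑ j : Fin M, if x t ∈ (B j).1 then r t (b j) else 0) -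
                  √(4 * M * Real.log (max (Fintype.card X : ℝ) ((K : ℝ) / M)) * (6 * K + 1) * T) ≤
                (A.learner lab K M T).expectedReward x r T) := by
  refine ⟨CBA.program, 1200, fun X _ _ K M T hX hK hM hT lab => ?_⟩
  obtain ⟨d, hd, hd', hstart⟩ := CBA.simulates_start (K := K) (M := M) (T := T) (lab := lab) hX
  have hsim := CBA.simulates_stateAfter hd hstart
  have hpos := CBA.initialWeights_pos (X := X) (K := K) (M := M) (by omega) hK hM
  have hpred : ∀ (h : List (X × Option (Fin K) × ℝ)) (x : X),
      (CBA.program.learner lab K M T).predict ((CBA.program.learner lab K M T).stateAfter h) x =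
        (CBA.algorithm (CBA.Prog.rate (Fintype.card X) K M T) (CBA.initialWeights M)
          CBA.ballExpert).predict ((CBA.algorithm (CBA.Prog.rate (Fintype.card X) K M T)
            (CBA.initialWeights M) CBA.ballExpert).stateAfter h) x :=
    fun h x => funext ((hsim h).chosen hd x).2.2.2
  refine ⟨⟨_, _, (CBA.rate_mem hX hK hM hT).1, (CBA.rate_mem hX hK hM hT).2, hpos, hpred⟩,
    fun h x => ?_, fun h x o rew => (hsim h).time_le hd hd' hX hK x o rew,
    fun x r hr B b hB => ?_⟩
  · rw [hpred]
    exact CBA.mixture_isStochasticAction (CBA.stateAfter_pos hpos h)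
  · rw [CBA.Learner.expectedReward_congr _ _ hpred]
    exact CBA.expectedReward_ge hX hK hM hT x r hr B b hB
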